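/- Let $N^5_s(c)$ be a smooth $5$-dimensional pseudo-Riemannian manifold of index $s$ and constant sectional curvature $c\in\mathbb R$, that is, with curvature tensor $\tilde R(X,Y)Z=c(\langle Y,Z\rangle X-\langle X,Z\rangle Y)$. Let $M^4_r$ be a connected smooth $4$-manifold and $x:M^4_r\to N^5_s(c)$ a smooth map whose induced metric is nondegenerate of index $r$ (a nondegenerate immersed hypersurface). Let $\vec\xi$ be a smooth unit normal vector field along $x$, $\langle\vec\xi,\vec\xi\rangle=\varepsilon$ with a constant $\varepsilon\in\{1,-1\}$. Denote by $\nabla$ and $\tilde\nabla$ the Levi-Civita connections of the induced metric and of $N^5_s(c)$ (the latter also acting on vector fields along $x$), by $A$ the shape operator, $x_*(AX)=-\tilde\nabla_X\vec\xi$, by $H=\tfrac14\,\varepsilon\operatorname{tr}A$ the mean curvature, by $\vec H=H\vec\xi$ the mean curvature vector field, and by $$\Delta V=-\sum_{i=1}^4\varepsilon_i\bigl(\tilde\nabla_{e_i}\tilde\nabla_{e_i}-\tilde\nabla_{\nabla_{e_i}e_i}\bigr)V$$ the Laplace operator on vector fields $V$ along $x$, where $\{e_i\}$ is a local orthonormal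 frame of $M^4_r$, $\langle e_i,e_i\rangle=\varepsilon_i=\pm1$. Suppose that $\Delta\vec H=\lambda\vec H$ for some constant $\lambda\in\mathbb R$, and that at every point of $M^4_r$ the shape operator $A$ has exactly one (a priori complex) eigenvalue, of whatever geometric multiplicity; $A$ is not assumed to be diagonalizable. Then: * if $\varepsilon\lambda\le 0$, then $H=0$ on $M^4_r$; * if $\varepsilon\lambda>0$, then either $H=0$ on all of $M^4_r$, or $H^2=\dfrac{\varepsilon\lambda}{4}$ on all of $M^4_r$. -/

import Mathlib

open scoped Manifold ContDiff
open Bundle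

noncomputable section

namespace PseudoRiem

/-! Coordinate calculus. A metric on an open subset of `ℝⁿ` is a function `G` with values in the
bilinear forms; a map from an open subset of `ℝᵐ` is a function `F`; a vector field along `F` is a
function `V` on `ℝᵐ` with values in `ℝⁿ`. -/

/-- The Cartesian space `ℝⁿ` in which the charts take their values. -/
abbrev Coord (n : ℕ) : Type := EuclideanSpace ℝ (Fin n)

/-- Bilinear forms on `ℝⁿ`. -/
abbrev CoordForm (n : ℕ) : Type := Coord n →L[ℝ] Coord n →L[ℝ] ℝ

/-- The coordinate vector `∂ᵢ`. -/
def basisVec {n : ℕ} (i : Fin n) : Coord n := EuclideanSpace.single i (1 : ℝ)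

/-- The matrix `gᵢⱼ` of a bilinear form. -/
def gram {n : ℕ} (B : CoordForm n) : Matrix (Fin n) (Fin n) ℝ :=
  Matrix.of fun i j => B (basisVec i) (basisVec j)

/-- The Levi-Civita connection in coordinates: `Γ(u, v)` is the vector with components
`Γᵏ(u, v) = ½ gᵏˡ (∂ᵤ g(v, ∂ₗ) + ∂ᵥ g(u, ∂ₗ) - ∂ₗ g(u, v))`, so that `∇ᵤ V = ∂ᵤ V + Γ(u, V)`. -/
def christoffel {n : ℕ} (G : Coord n → CoordForm n) (y u v : Coord n) : Coord n :=
  ∑ k, ∑ l, ((gram (G y))⁻¹ k l *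
    (1 / 2 * (fderiv ℝ G y u v (basisVec l) + fderiv ℝ G y v u (basisVec l)
      - fderiv ℝ G y (basisVec l) u v))) • basisVec k

/-- The covariant derivative at `q`, in the direction `u`, of a vector field `V` along the map `F`
into a space with metric `G`; for `F = id` this is the Levi-Civita connection of `G` itself. -/
def covDeriv {m n : ℕ} (G : Coord n → CoordForm n) (F V : Coord m → Coord n) (q u : Coord m) :
    Coord n :=
  fderiv ℝ V q u + christoffel G (F q) (fderiv ℝ F q u) (V q)

/-- The curvature tensor `R(X, Y) Z = ∇_X ∇_Y Z - ∇_Y ∇_X Z - ∇_[X, Y] Z`, evaluated on the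
constant vector fields `u`, `v`, `w` (for which `[u, v] = 0`). -/
def curvature {n : ℕ} (G : Coord n → CoordForm n) (y u v w : Coord n) : Coord n :=
  covDeriv G id (fun z => covDeriv G id (fun _ => w) z v) y u
    - covDeriv G id (fun z => covDeriv G id (fun _ => w) z u) y v

/-- The second covariant derivative `∇̃ᵤ ∇̃ᵥ V - ∇̃_(∇ᵤ v) V` of a vector field `V` along `F`,
where `∇` is the Levi-Civita connection of the metric `h` of the domain, and `u`, `v` are constant
vector fields. -/
def secondCovDeriv {m n : ℕ} (h : Coord m → CoordForm m) (G : Coord n → CoordForm n)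
    (F V : Coord m → Coord n) (q u v : Coord m) : Coord n :=
  covDeriv G F (fun z => covDeriv G F V z v) q u - covDeriv G F V q (christoffel h q u v)

/-- The Laplace operator `Δ V = - hⁱʲ (∇̃ᵢ ∇̃ⱼ - ∇̃_(∇ᵢ ∂ⱼ)) V` on vector fields along `F`. -/
def laplacian {m n : ℕ} (h : Coord m → CoordForm m) (G : Coord n → CoordForm n)
    (F V : Coord m → Coord n) (q : Coord m) : Coord n :=
  - ∑ i, ∑ j, (gram (h q))⁻¹ i j • secondCovDeriv h G F V q (basisVec i) (basisVec j)

/-- The matrix `Aⁱₖ = hⁱʲ ⟨-∇̃ₖ ξ, F_* ∂ⱼ⟩` of the shape operator associated with a vector field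
`ξ` normal to the immersion `F`, whose induced metric is `h`. -/
def shapeMatrix {m n : ℕ} (h : Coord m → CoordForm m) (G : Coord n → CoordForm n)
    (F ξ : Coord m → Coord n) (q : Coord m) : Matrix (Fin m) (Fin m) ℝ :=
  Matrix.of fun i k => ∑ j, (gram (h q))⁻¹ i j *
    G (F q) (-covDeriv G F ξ q (basisVec k)) (fderiv ℝ F q (basisVec j))

/-! Manifolds. -/

section Manifolds

variable {m n : ℕ}
  {M : Type*} [TopologicalSpace M] [ChartedSpace (Coord m) M]
  {N : Type*} [TopologicalSpace N] [ChartedSpace (Coord n) N]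

/-- The quadratic form `v ↦ B(v, v)` of a bilinear form on a tangent space. -/
def quadForm {p : N} (B : TangentSpace (𝓡 n) p →L[ℝ] TangentSpace (𝓡 n) p →L[ℝ] ℝ) :
    QuadraticForm ℝ (TangentSpace (𝓡 n) p) :=
  LinearMap.BilinMap.toQuadraticMap (ContinuousLinearMap.toLinearMap₁₂ B)

variable (n N) in
/-- A smooth pseudo-Riemannian metric. -/
structure Metric [IsManifold (𝓡 n) ∞ N] where
  val : ∀ p : N, TangentSpace (𝓡 n) p →L[ℝ] TangentSpace (𝓡 n) p →L[ℝ] ℝ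
  symm : ∀ p u v, val p u v = val p v u
  nondegenerate : ∀ p u, (∀ v, val p u v = 0) → u = 0
  contMDiff : ContMDiff (𝓡 n) ((𝓡 n).prod 𝓘(ℝ, CoordForm n)) ∞
    (fun p => TotalSpace.mk' (CoordForm n) p (val p))

/-- The coordinate expression of a field of bilinear forms in the chart `ψ`. -/
def coordForm (ψ : OpenPartialHomeomorph N (Coord n))
    (g : ∀ p : N, TangentSpace (𝓡 n) p →L[ℝ] TangentSpace (𝓡 n) p →L[ℝ] ℝ)
    (y : Coord n) : CoordForm n :=
  let L : Coord n →L[ℝ] TangentSpace (𝓡 n) (ψ.symm y) := mfderiv 𝓘(ℝ, Coord n) (𝓡 n) ψ.symm y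
  (ContinuousLinearMap.precomp ℝ L).comp ((g (ψ.symm y)).comp L)

/-- The coordinate expression of a map in the charts `φ` and `ψ`. -/
def coordMap (φ : OpenPartialHomeomorph M (Coord m)) (ψ : OpenPartialHomeomorph N (Coord n))
    (x : M → N) (q : Coord m) : Coord n :=
  ψ (x (φ.symm q))

/-- The coordinate expression of a vector field along `x` in the charts `φ` and `ψ`. -/
def coordField (φ : OpenPartialHomeomorph M (Coord m)) (ψ : OpenPartialHomeomorph N (Coord n))
    (x : M → N) (V : ∀ p : M, TangentSpace (𝓡 n) (x p)) (q : Coord m) : Coord n :=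
  mfderiv (𝓡 n) 𝓘(ℝ, Coord n) ψ (x (φ.symm q)) (V (φ.symm q))

/-- The metric `x^* g` induced on `M` by a map `x : M → N`. -/
def inducedForm (g : ∀ y : N, TangentSpace (𝓡 n) y →L[ℝ] TangentSpace (𝓡 n) y →L[ℝ] ℝ)
    (x : M → N) (p : M) : TangentSpace (𝓡 m) p →L[ℝ] TangentSpace (𝓡 m) p →L[ℝ] ℝ :=
  (ContinuousLinearMap.precomp ℝ (mfderiv (𝓡 m) (𝓡 n) x p)).comp
    ((g (x p)).comp (mfderiv (𝓡 m) (𝓡 n) x p))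

variable [IsManifold (𝓡 n) ∞ N]

/-- The metric has index `s` and constant sectional curvature `c`, that is,
`R(X, Y) Z = c (⟨Y, Z⟩ X - ⟨X, Z⟩ Y)`. -/
structure IsSpaceForm (g : Metric n N) (s : ℕ) (c : ℝ) : Prop where
  index_eq : ∀ p, sigNeg (quadForm (g.val p)) = s
  curvature_eq : ∀ ψ ∈ atlas (Coord n) N, ∀ y ∈ ψ.target, ∀ u v w : Coord n,
    curvature (coordForm ψ g.val) y u v w =
      c • (coordForm ψ g.val y v w • u - coordForm ψ g.val y u w • v)

/-- `x` is a smooth map whose induced metric is nondegenerate of index `r`. In particular, `x` is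
an immersion, isometric for the induced metric. -/
structure IsNondegenerateImmersion (m : ℕ) {M : Type*} [TopologicalSpace M]
    [ChartedSpace (Coord m) M] (g : Metric n N) (x : M → N) (r : ℕ) : Prop where
  contMDiff : ContMDiff (𝓡 m) (𝓡 n) ∞ x
  nondegenerate : ∀ (p : M) (u : TangentSpace (𝓡 m) p),
    (∀ v, inducedForm g.val x p u v = 0) → u = 0
  index_eq : ∀ p : M, sigNeg (quadForm (n := m) (inducedForm g.val x p)) = r

/-- `ξ` is a smooth vector field along `x`, normal to `M`, with `⟨ξ, ξ⟩ = ε`. -/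
structure IsUnitNormal (m : ℕ) {M : Type*} [TopologicalSpace M]
    [ChartedSpace (Coord m) M] (g : Metric n N) (x : M → N)
    (ξ : ∀ p : M, TangentSpace (𝓡 n) (x p)) (ε : ℝ) : Prop where
  contMDiff : ContMDiff (𝓡 m) (𝓡 n).tangent ∞ (fun p => (⟨x p, ξ p⟩ : TangentBundle (𝓡 n) N))
  normal : ∀ (p : M) (v : TangentSpace (𝓡 m) p),
    g.val (x p) (ξ p) (mfderiv (𝓡 m) (𝓡 n) x p v) = 0
  unit : ∀ p, g.val (x p) (ξ p) (ξ p) = ε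

/-- The shape operator `A` of `M` associated with `ξ`, at the point `p`, as a matrix with respect
to the coordinate basis of the preferred chart at `p`. -/
def shapeOperator (g : Metric n N) (x : M → N) (ξ : ∀ p : M, TangentSpace (𝓡 n) (x p)) (p : M) :
    Matrix (Fin m) (Fin m) ℝ :=
  shapeMatrix (coordForm (chartAt (Coord m) p) (inducedForm g.val x))
    (coordForm (chartAt (Coord n) (x p)) g.val)
    (coordMap (chartAt (Coord m) p) (chartAt (Coord n) (x p)) x)
    (coordField (chartAt (Coord m) p) (chartAt (Coord n) (x p)) x ξ)
    (chartAt (Coord m) p p)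

/-- The principal curvatures at `p`: the real and imaginary eigenvalues of the shape operator. -/
def principalCurvatures (g : Metric n N) (x : M → N) (ξ : ∀ p : M, TangentSpace (𝓡 n) (x p))
    (p : M) : Set ℂ :=
  {z | ((shapeOperator (m := m) g x ξ p).map (algebraMap ℝ ℂ)).charpoly.IsRoot z}

/-- The mean curvature `H = (1/m) ε tr A` of `M`, where `m = dim M`. -/
def meanCurvature (g : Metric n N) (x : M → N) (ξ : ∀ p : M, TangentSpace (𝓡 n) (x p)) (ε : ℝ)
    (p : M) : ℝ :=
  1 / (m : ℝ) * ε * (shapeOperator (m := m) g x ξ p).trace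

/-- The mean curvature vector field `H ξ`. -/
def meanCurvatureVector (g : Metric n N) (x : M → N) (ξ : ∀ p : M, TangentSpace (𝓡 n) (x p))
    (ε : ℝ) (p : M) : TangentSpace (𝓡 n) (x p) :=
  meanCurvature (m := m) g x ξ ε p • ξ p

/-- `Δ V = W` for vector fields `V`, `W` along the immersion `x`, where `Δ` is the Laplace operator
of `M` with the induced metric, formed with the Levi-Civita connections of `M` and `N`; the
equation is expressed in local coordinates of `M` and `N`. -/
def LaplacianEq (m : ℕ) {M : Type*} [TopologicalSpace M] [ChartedSpace (Coord m) M]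
    (g : Metric n N) (x : M → N) (V W : ∀ p : M, TangentSpace (𝓡 n) (x p)) : Prop :=
  ∀ φ ∈ atlas (Coord m) M, ∀ ψ ∈ atlas (Coord n) N, ∀ q ∈ φ.target, x (φ.symm q) ∈ ψ.source →
    laplacian (coordForm φ (inducedForm g.val x)) (coordForm ψ g.val) (coordMap φ ψ x)
      (coordField φ ψ x V) q = coordField φ ψ x W q

end Manifolds

end PseudoRiem

end

/-! Let `a` be the single eigenvalue of `A` at a point. It is real, because `4a = tr A`, and `A - a`
is nilpotent by Cayley–Hamilton. Hence `a = εH` and `tr A² = 4a² = 4H²`. Only nilpotency enters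
below, so neither diagonalizability nor a frame of eigenvectors is needed.

The Gauss and Weingarten formulas split `Δ(Hξ)` into tangential and normal parts. Symmetry of `A`
and the Codazzi equation for constant curvature turn the trace of `∇A` into `d(tr A)`, so pairing
with a tangent vector `w` gives `2 dH(Aw) + H d(tr A)(w)` (`form_connLaplacian_tangent`). Since
`λHξ` is normal and `tr A = 4εH`, this becomes `dH(Aw) = -2a dH(w)`. Thus `dH` is an eigencovector
of `A` for `-2a`. If `a ≠ 0`, then `-2a` is not the eigenvalue `a`, so `dH = 0`
(`eq_zero_of_isNilpotent_sub`). At every point, therefore, `H = 0` or `dH = 0`, and in both cases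
`d(H²) = 2H dH = 0`. By connectedness `H²` is constant.

If `H` vanishes somewhere, it vanishes everywhere. Otherwise `dH = 0` on all of `M`, and the normal
part (`form_connLaplacian_normal`) reads `H tr A² = ελH`, that is `H² = ελ/4`, which is impossible
for `ελ ≤ 0`.

The identities are proved for open sets of normed spaces with any torsion-free metric connection
(`IsLeviCivita`, `IsHypersurface`) and then specialized to Christoffel symbols in charts. The mean
curvature at `p` is defined in the preferred charts at `p` and `x p`, so `trace_shapeMatrix_chart`
is needed to differentiate it in one fixed chart. -/

namespace PseudoRiem

/-! ### Raising and lowering indices, and traces, for a nondegenerate form on `ℝⁿ`. -/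

section LinearAlgebra

variable {n : ℕ}

lemma sum_smul_basisVec (v : Coord n) : ∑ i, v i • basisVec i = v := by
  ext j
  simp [basisVec, Pi.single_apply]

lemma clm_eq_sum {W : Type*} [NormedAddCommGroup W] [NormedSpace ℝ W] (L : Coord n →L[ℝ] W)
    (v : Coord n) : L v = ∑ i, v i • L (basisVec i) := by
  conv_lhs => rw [← sum_smul_basisVec v]
  simp

lemma form_ext {a b : Coord n →L[ℝ] ℝ} (h : ∀ i, a (basisVec i) = b (basisVec i)) : a = b := by
  ext v
  rw [clm_eq_sum a, clm_eq_sum b]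
  simp [h]

lemma gram_apply (B : CoordForm n) (i j : Fin n) : gram B i j = B (basisVec i) (basisVec j) := rfl

lemma gram_det_ne_zero {B : CoordForm n} (hB : ∀ u, (∀ v, B u v = 0) → u = 0) :
    (gram B).det ≠ 0 := by
  intro h0
  obtain ⟨v, hv, hv0⟩ := Matrix.exists_vecMul_eq_zero_iff.2 h0
  apply hv
  have h1 : (WithLp.toLp 2 v : Coord n) = 0 := by
    apply hB
    have : B (WithLp.toLp 2 v : Coord n) = 0 := by
      apply form_ext
      intro j
      rw [clm_eq_sum B]
      have := congrFun hv0 j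
      simpa [Matrix.vecMul, dotProduct, gram_apply] using this
    intro w
    rw [this]; rfl
  have := congrArg (fun z : Coord n => z.ofLp) h1
  simpa using this

lemma gram_mul_inv {B : CoordForm n} (hB : ∀ u, (∀ v, B u v = 0) → u = 0) :
    gram B * (gram B)⁻¹ = 1 :=
  Matrix.mul_nonsing_inv _ (gram_det_ne_zero hB).isUnit

/-- Raising an index is inverse to lowering it. -/
lemma form_sharp {B : CoordForm n} (hs : ∀ u v, B u v = B v u)
    (hB : ∀ u, (∀ v, B u v = 0) → u = 0) (a : Coord n →L[ℝ] ℝ) (w : Coord n) :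
    B (∑ k, ∑ l, ((gram B)⁻¹ k l * a (basisVec l)) • basisVec k) w = a w := by
  suffices h : B (∑ k, ∑ l, ((gram B)⁻¹ k l * a (basisVec l)) • basisVec k) = a by rw [h]
  apply form_ext
  intro j
  have h1 : ∀ l, ∑ k, (gram B)⁻¹ k l * gram B k j = (1 : Matrix _ _ ℝ) j l := by
    intro l
    rw [← gram_mul_inv hB, Matrix.mul_apply]
    refine Finset.sum_congr rfl fun k _ => ?_
    rw [gram_apply, gram_apply, hs, mul_comm]
  simp only [map_sum, map_smul, sum_apply, smul_apply,
    smul_eq_mul, ← gram_apply]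
  rw [Finset.sum_comm]
  calc _ = ∑ l, a (basisVec l) * (1 : Matrix _ _ ℝ) j l := by
        refine Finset.sum_congr rfl fun l _ => ?_
        rw [← h1, Finset.mul_sum]
        refine Finset.sum_congr rfl fun k _ => ?_
        ring
    _ = _ := by simp [Matrix.one_apply]

/-- Lowering an index is inverse to raising it. -/
lemma sharp_form {B : CoordForm n} (hs : ∀ u v, B u v = B v u)
    (hB : ∀ u, (∀ v, B u v = 0) → u = 0) (w : Coord n) :
    ∑ k, ∑ l, ((gram B)⁻¹ k l * B w (basisVec l)) • basisVec k = w := by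
  apply sub_eq_zero.1
  apply hB
  intro v
  rw [map_sub, sub_apply, form_sharp hs hB, sub_self]

/-- The metric trace of `B(T ·, ·)` is the trace of `T`. -/
lemma sum_gram_inv_form {B : CoordForm n} (hs : ∀ u v, B u v = B v u)
    (hB : ∀ u, (∀ v, B u v = 0) → u = 0) (T : Coord n →L[ℝ] Coord n) :
    ∑ i, ∑ j, (gram B)⁻¹ i j * B (T (basisVec i)) (basisVec j) = ∑ i, T (basisVec i) i := by
  refine Finset.sum_congr rfl fun i _ => ?_
  have := congrArg (fun z : Coord n => z i) (sharp_form hs hB (T (basisVec i)))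
  rw [← this]
  simp [basisVec, Pi.single_apply]

lemma trace_comp_comm (S T : Coord n →L[ℝ] Coord n) :
    ∑ i, S (T (basisVec i)) i = ∑ i, T (S (basisVec i)) i := by
  have h : ∀ (S T : Coord n →L[ℝ] Coord n) i, S (T (basisVec i)) i
      = ∑ j, T (basisVec i) j * S (basisVec j) i := by
    intro S T i
    rw [clm_eq_sum S]
    simp
  simp only [h]
  rw [Finset.sum_comm]
  refine Finset.sum_congr rfl fun i _ => Finset.sum_congr rfl fun j _ => mul_comm _ _

end LinearAlgebra

/-! ### The Christoffel symbols: bilinearity, Koszul formula, symmetry, smoothness. -/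

section Christoffel

variable {n : ℕ}

lemma christoffel_add_left (G : Coord n → CoordForm n) (y u u' v : Coord n) :
    christoffel G y (u + u') v = christoffel G y u v + christoffel G y u' v := by
  simp only [christoffel, map_add, add_apply, ← Finset.sum_add_distrib]
  refine Finset.sum_congr rfl fun k _ => Finset.sum_congr rfl fun l _ => ?_
  module

lemma christoffel_smul_left (G : Coord n → CoordForm n) (y : Coord n) (a : ℝ) (u v : Coord n) :
    christoffel G y (a • u) v = a • christoffel G y u v := by
  simp only [christoffel, map_smul, smul_apply, Finset.smul_sum, smul_eq_mul]
  refine Finset.sum_congr rfl fun k _ => Finset.sum_congr rfl fun l _ => ?_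
  module

lemma christoffel_add_right (G : Coord n → CoordForm n) (y u v v' : Coord n) :
    christoffel G y u (v + v') = christoffel G y u v + christoffel G y u v' := by
  simp only [christoffel, map_add, add_apply, ← Finset.sum_add_distrib]
  refine Finset.sum_congr rfl fun k _ => Finset.sum_congr rfl fun l _ => ?_
  module

lemma christoffel_smul_right (G : Coord n → CoordForm n) (y : Coord n) (a : ℝ) (u v : Coord n) :
    christoffel G y u (a • v) = a • christoffel G y u v := by
  simp only [christoffel, map_smul, smul_apply, Finset.smul_sum, smul_eq_mul]
  refine Finset.sum_congr rfl fun k _ => Finset.sum_congr rfl fun l _ => ?_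
  module

/-- The Levi-Civita connection as a bilinear map. -/
noncomputable def christoffelMap (G : Coord n → CoordForm n) (y : Coord n) :
    Coord n →L[ℝ] Coord n →L[ℝ] Coord n :=
  LinearMap.toContinuousBilinearMap (LinearMap.mk₂ ℝ (christoffel G y)
    (christoffel_add_left G y) (christoffel_smul_left G y)
    (christoffel_add_right G y) (christoffel_smul_right G y))

lemma christoffelMap_apply (G : Coord n → CoordForm n) (y u v : Coord n) :
    christoffelMap G y u v = christoffel G y u v := rfl

/-- The Koszul formula. -/
lemma form_christoffel {G : Coord n → CoordForm n} {y : Coord n} (hs : ∀ u v, G y u v = G y v u)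
    (hB : ∀ u, (∀ v, G y u v = 0) → u = 0) (u v w : Coord n) :
    G y (christoffel G y u v) w = 1 / 2 * (fderiv ℝ G y u v w + fderiv ℝ G y v u w
      - fderiv ℝ G y w u v) := by
  have := form_sharp hs hB ((1 / 2 : ℝ) • (fderiv ℝ G y u v + fderiv ℝ G y v u
      - ((ContinuousLinearMap.apply ℝ ℝ v).comp
        ((ContinuousLinearMap.apply ℝ (Coord n →L[ℝ] ℝ) u).comp (fderiv ℝ G y))))) w
  simpa [christoffel] using this

lemma fderiv_form_symm {G : Coord n → CoordForm n} {y : Coord n}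
    (hG : DifferentiableAt ℝ G y)
    (hs : ∀ᶠ z in nhds y, ∀ u v, G z u v = G z v u) (w u v : Coord n) :
    fderiv ℝ G y w u v = fderiv ℝ G y w v u := by
  have h1 : ∀ u v, fderiv ℝ (fun z => G z u v) y w = fderiv ℝ G y w u v := by
    intro u v
    rw [fderiv_clm_apply (hG.clm_apply (differentiableAt_const _)) (differentiableAt_const _),
      fderiv_clm_apply hG (differentiableAt_const _)]
    simp
  rw [← h1, ← h1]
  have : (fun z => G z u v) =ᶠ[nhds y] (fun z => G z v u) := by
    filter_upwards [hs] with z hz using hz u v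
  rw [this.fderiv_eq]

lemma christoffel_symm {G : Coord n → CoordForm n} {y : Coord n} (hG : DifferentiableAt ℝ G y)
    (hs : ∀ᶠ z in nhds y, ∀ u v, G z u v = G z v u) (u v : Coord n) :
    christoffel G y u v = christoffel G y v u := by
  simp only [christoffel, fderiv_form_symm hG hs _ u v, add_comm]

/-- Cramer's rule: the entries of the inverse are quotients of polynomials in the `gᵢⱼ`, with
denominator the nonvanishing Gram determinant. -/
lemma contDiffOn_gram_inv {G : Coord n → CoordForm n} {Ω : Set (Coord n)} 
    (hG : ContDiffOn ℝ ∞ G Ω) (hB : ∀ y ∈ Ω, ∀ u, (∀ v, G y u v = 0) → u = 0) (k l : Fin n) :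
    ContDiffOn ℝ ∞ (fun y => (gram (G y))⁻¹ k l) Ω := by
  have hg : ∀ i j, ContDiffOn ℝ ∞ (fun y => gram (G y) i j) Ω := fun i j =>
    (hG.clm_apply contDiffOn_const).clm_apply contDiffOn_const
  have hdet : ∀ g : Coord n → Matrix (Fin n) (Fin n) ℝ,
      (∀ i j, ContDiffOn ℝ ∞ (fun y => g y i j) Ω) → ContDiffOn ℝ ∞ (fun y => (g y).det) Ω := by
    intro g hg
    simp only [Matrix.det_apply]
    exact ContDiffOn.sum fun σ _ => (contDiffOn_prod fun i _ => hg _ _).const_smul _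
  simp only [Matrix.inv_def, Ring.inverse_eq_inv', Matrix.smul_apply, Matrix.adjugate_apply]
  refine ((hdet _ hg).inv fun y hy => gram_det_ne_zero (hB y hy)).smul (hdet _ fun i j => ?_)
  simp only [Matrix.updateRow_apply]
  split_ifs
  · exact contDiffOn_const
  · exact hg _ _

set_option synthInstance.maxHeartbeats 200000 in
lemma contDiffOn_christoffelMap {G : Coord n → CoordForm n} {Ω : Set (Coord n)} (hΩ : IsOpen Ω)
    (hG : ContDiffOn ℝ ∞ G Ω) (hB : ∀ y ∈ Ω, ∀ u, (∀ v, G y u v = 0) → u = 0) :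
    ContDiffOn ℝ ∞ (christoffelMap G) Ω := by
  refine contDiffOn_clm_apply.2 fun u => contDiffOn_clm_apply.2 fun v => ?_
  simp only [christoffelMap_apply, christoffel]
  have hd := hG.fderiv_of_isOpen hΩ (m := ∞) le_rfl
  have h3 : ∀ a b c, ContDiffOn ℝ ∞ (fun y => fderiv ℝ G y a b c) Ω := fun a b c =>
    ((hd.clm_apply contDiffOn_const).clm_apply contDiffOn_const).clm_apply contDiffOn_const
  exact ContDiffOn.sum fun k _ => ContDiffOn.sum fun l _ =>
    ((contDiffOn_gram_inv hG hB k l).mul (contDiffOn_const.mul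
      (((h3 _ _ _).add (h3 _ _ _)).sub (h3 _ _ _)))).smul contDiffOn_const

end Christoffel
set_option synthInstance.maxHeartbeats 200000
set_option maxHeartbeats 400000

/-! ### Covariant derivatives along maps for an abstract Levi-Civita connection. -/

section Connection

variable {E E' E'' : Type*} [NormedAddCommGroup E] [NormedSpace ℝ E]
  [NormedAddCommGroup E'] [NormedSpace ℝ E'] [NormedAddCommGroup E''] [NormedSpace ℝ E'']

lemma differentiableAt_of_contDiffOn {f : E → E'} {U : Set E} (hf : ContDiffOn ℝ ∞ f U)
    (hU : IsOpen U) {q : E} (hq : q ∈ U) : DifferentiableAt ℝ f q :=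
  (hf.contDiffAt (hU.mem_nhds hq)).differentiableAt (by simp)

/-- The derivative along the map `F` of a vector field `V`, for the connection `Γ`. -/
noncomputable def connDeriv (Γ : E' → E' →L[ℝ] E' →L[ℝ] E') (F V : E → E') (q u : E) : E' :=
  fderiv ℝ V q u + Γ (F q) (fderiv ℝ F q u) (V q)

lemma contDiffOn_connDeriv {Γ : E' → E' →L[ℝ] E' →L[ℝ] E'} {Ω : Set E'} {U : Set E}
    (hU : IsOpen U) (hΓ : ContDiffOn ℝ ∞ Γ Ω) {F V : E → E'} (hF : ContDiffOn ℝ ∞ F U)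
    (hFU : Set.MapsTo F U Ω) (hV : ContDiffOn ℝ ∞ V U) (u : E) :
    ContDiffOn ℝ ∞ (fun q => connDeriv Γ F V q u) U :=
  ((hV.fderiv_of_isOpen hU (m := ∞) le_rfl).clm_apply contDiffOn_const).add
    (((hΓ.comp hF hFU).clm_apply
      ((hF.fderiv_of_isOpen hU (m := ∞) le_rfl).clm_apply contDiffOn_const)).clm_apply hV)

lemma connDeriv_congr {Γ : E' → E' →L[ℝ] E' →L[ℝ] E'} {F V W : E → E'} {q : E}
    (h : V =ᶠ[nhds q] W) (u : E) : connDeriv Γ F V q u = connDeriv Γ F W q u := by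
  simp only [connDeriv, h.fderiv_eq, h.self_of_nhds]

lemma connDeriv_add {Γ : E' → E' →L[ℝ] E' →L[ℝ] E'} {F V W : E → E'} {q : E}
    (hV : DifferentiableAt ℝ V q) (hW : DifferentiableAt ℝ W q) (u : E) :
    connDeriv Γ F (fun z => V z + W z) q u = connDeriv Γ F V q u + connDeriv Γ F W q u := by
  simp only [connDeriv, fderiv_fun_add hV hW, map_add, add_apply]
  abel

lemma connDeriv_smul {Γ : E' → E' →L[ℝ] E' →L[ℝ] E'} {F V : E → E'} {f : E → ℝ} {q : E}
    (hf : DifferentiableAt ℝ f q) (hV : DifferentiableAt ℝ V q) (u : E) :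
    connDeriv Γ F (fun z => f z • V z) q u
      = fderiv ℝ f q u • V q + f q • connDeriv Γ F V q u := by
  simp only [connDeriv, fderiv_fun_smul hf hV, map_smul, add_apply, smul_apply,
    ContinuousLinearMap.smulRight_apply, smul_add]
  abel

lemma connDeriv_neg {Γ : E' → E' →L[ℝ] E' →L[ℝ] E'} {F V : E → E'} {q : E} (u : E) :
    connDeriv Γ F (fun z => - V z) q u = - connDeriv Γ F V q u := by
  simp only [connDeriv, fderiv_fun_neg, map_neg, neg_apply]
  abel

/-- `Γ` is the Levi-Civita connection of the smooth nondegenerate metric `G` on the open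
set `Ω`. -/
structure IsLeviCivita (G : E' → E' →L[ℝ] E' →L[ℝ] ℝ) (Γ : E' → E' →L[ℝ] E' →L[ℝ] E')
    (Ω : Set E') : Prop where
  isOpen : IsOpen Ω
  metric_contDiffOn : ContDiffOn ℝ ∞ G Ω
  conn_contDiffOn : ContDiffOn ℝ ∞ Γ Ω
  symm : ∀ y ∈ Ω, ∀ u v, G y u v = G y v u
  nondegenerate : ∀ y ∈ Ω, ∀ u, (∀ v, G y u v = 0) → u = 0
  torsion : ∀ y ∈ Ω, ∀ u v, Γ y u v = Γ y v u
  compat : ∀ y ∈ Ω, ∀ w u v, fderiv ℝ G y w u v = G y (Γ y w u) v + G y u (Γ y w v)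

variable {G : E' → E' →L[ℝ] E' →L[ℝ] ℝ} {Γ : E' → E' →L[ℝ] E' →L[ℝ] E'} {Ω : Set E'}

/-- The connection is metric along maps. -/
lemma IsLeviCivita.fderiv_form (hG : IsLeviCivita G Γ Ω) {F V W : E → E'} {q : E} (hq : F q ∈ Ω)
    (hF : DifferentiableAt ℝ F q) (hV : DifferentiableAt ℝ V q) (hW : DifferentiableAt ℝ W q)
    (u : E) : fderiv ℝ (fun z => G (F z) (V z) (W z)) q u
      = G (F q) (connDeriv Γ F V q u) (W q) + G (F q) (V q) (connDeriv Γ F W q u) := by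
  have hGd := differentiableAt_of_contDiffOn hG.metric_contDiffOn hG.isOpen hq
  have hGF : DifferentiableAt ℝ (fun z => G (F z)) q := hGd.comp q hF
  rw [fderiv_clm_apply (hGF.clm_apply hV) hW, fderiv_clm_apply hGF hV]
  have : fderiv ℝ (fun z => G (F z)) q = (fderiv ℝ G (F q)).comp (fderiv ℝ F q) :=
    fderiv_comp q hGd hF
  simp only [this, connDeriv, add_apply, ContinuousLinearMap.comp_apply,
    ContinuousLinearMap.flip_apply, map_add, hG.compat _ hq]
  ring

lemma fderiv_fderiv_apply {F : E → E'} {U : Set E} (hU : IsOpen U) (hF : ContDiffOn ℝ ∞ F U)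
    {q : E} (hq : q ∈ U) (u v : E) :
    fderiv ℝ (fun z => fderiv ℝ F z v) q u = fderiv ℝ (fderiv ℝ F) q u v := by
  rw [fderiv_clm_apply (differentiableAt_of_contDiffOn
    (hF.fderiv_of_isOpen hU (m := ∞) le_rfl) hU hq) (differentiableAt_const _)]
  simp

lemma fderiv_fderiv_symm {F : E → E'} {U : Set E} (hU : IsOpen U) (hF : ContDiffOn ℝ ∞ F U)
    {q : E} (hq : q ∈ U) (u v : E) :
    fderiv ℝ (fderiv ℝ F) q u v = fderiv ℝ (fderiv ℝ F) q v u :=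
  ((hF.contDiffAt (hU.mem_nhds hq)).isSymmSndFDerivAt (by
    rw [minSmoothness_of_isRCLikeNormedField]; exact WithTop.coe_le_coe.2 le_top)).eq u v

/-- The second derivative of `F` is symmetric and `Γ` is torsion-free. This symmetry later makes the
shape operator self-adjoint. -/
lemma IsLeviCivita.connDeriv_fderiv_symm (hG : IsLeviCivita G Γ Ω) {F : E → E'} {U : Set E}
    (hU : IsOpen U) (hF : ContDiffOn ℝ ∞ F U) {q : E} (hq : q ∈ U) (hFq : F q ∈ Ω) (u v : E) :
    connDeriv Γ F (fun z => fderiv ℝ F z v) q u = connDeriv Γ F (fun z => fderiv ℝ F z u) q v := by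
  simp only [connDeriv, fderiv_fderiv_apply hU hF hq, fderiv_fderiv_symm hU hF hq u v,
    hG.torsion _ hFq (fderiv ℝ F q u)]

/-- The curvature of the connection `Γ`, on constant vector fields. -/
noncomputable def connCurvature (Γ : E' → E' →L[ℝ] E' →L[ℝ] E') (y u v w : E') : E' :=
  connDeriv Γ id (fun z => connDeriv Γ id (fun _ => w) z v) y u
    - connDeriv Γ id (fun z => connDeriv Γ id (fun _ => w) z u) y v

lemma connCurvature_eq {y : E'} (hΓ : DifferentiableAt ℝ Γ y) (u v w : E') :
    connCurvature Γ y u v w = fderiv ℝ Γ y u v w - fderiv ℝ Γ y v u w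
      + Γ y u (Γ y v w) - Γ y v (Γ y u w) := by
  have h : ∀ u v, fderiv ℝ (fun z => Γ z v w) y u = fderiv ℝ Γ y u v w := by
    intro u v
    rw [fderiv_clm_apply (hΓ.clm_apply (differentiableAt_const _)) (differentiableAt_const _),
      fderiv_clm_apply hΓ (differentiableAt_const _)]
    simp
  simp only [connCurvature, connDeriv, fderiv_id, id, fderiv_fun_const, Pi.zero_apply,
    zero_apply, zero_add, ContinuousLinearMap.id_apply, h]
  abel

/-- Covariant derivatives along a map commute up to the curvature. -/
lemma connDeriv_comm {F V : E → E'} {U : Set E} (hΩ : IsOpen Ω) (hΓ : ContDiffOn ℝ ∞ Γ Ω)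
    (hU : IsOpen U) (hF : ContDiffOn ℝ ∞ F U) (hFU : Set.MapsTo F U Ω)
    (hV : ContDiffOn ℝ ∞ V U) {q : E} (hq : q ∈ U)
    (u v : E) : connDeriv Γ F (fun z => connDeriv Γ F V z v) q u
      - connDeriv Γ F (fun z => connDeriv Γ F V z u) q v
      = connCurvature Γ (F q) (fderiv ℝ F q u) (fderiv ℝ F q v) (V q) := by
  have hΓd := differentiableAt_of_contDiffOn hΓ hΩ (hFU hq)
  have hFd := differentiableAt_of_contDiffOn hF hU hq
  have hVd := differentiableAt_of_contDiffOn hV hU hq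
  have hFd' := differentiableAt_of_contDiffOn (hF.fderiv_of_isOpen hU (m := ∞) le_rfl) hU hq
  have hVd' := differentiableAt_of_contDiffOn (hV.fderiv_of_isOpen hU (m := ∞) le_rfl) hU hq
  have hΓF : DifferentiableAt ℝ (fun z => Γ (F z)) q := hΓd.comp q hFd
  have hFv : ∀ v, DifferentiableAt ℝ (fun z => fderiv ℝ F z v) q := fun v =>
    hFd'.clm_apply (differentiableAt_const _)
  have hcomp : fderiv ℝ (fun z => Γ (F z)) q = (fderiv ℝ Γ (F q)).comp (fderiv ℝ F q) :=
    fderiv_comp q hΓd hFd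
  have h : ∀ u v, fderiv ℝ (fun z => connDeriv Γ F V z v) q u
      = fderiv ℝ (fderiv ℝ V) q u v
        + (fderiv ℝ Γ (F q) (fderiv ℝ F q u) (fderiv ℝ F q v) (V q)
          + Γ (F q) (fderiv ℝ (fderiv ℝ F) q u v) (V q)
          + Γ (F q) (fderiv ℝ F q v) (fderiv ℝ V q u)) := by
    intro u v
    simp only [connDeriv]
    rw [fderiv_fun_add (hVd'.clm_apply (differentiableAt_const _))
      ((hΓF.clm_apply (hFv v)).clm_apply hVd), add_apply, fderiv_fderiv_apply hU hV hq,
      fderiv_clm_apply (hΓF.clm_apply (hFv v)) hVd, fderiv_clm_apply hΓF (hFv v), hcomp]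
    simp only [add_apply, ContinuousLinearMap.comp_apply, ContinuousLinearMap.flip_apply,
      fderiv_fderiv_apply hU hF hq]
    abel
  rw [connCurvature_eq hΓd]
  simp only [connDeriv] at h ⊢
  simp only [h, fderiv_fderiv_symm hU hF hq u v, fderiv_fderiv_symm hU hV hq u v, map_add]
  abel

/-- The tangential part of the Gauss formula: a map is affine up to normal terms for the
connection of the metric which it induces. -/
lemma IsLeviCivita.form_connDeriv_fderiv {h : E → E →L[ℝ] E →L[ℝ] ℝ}
    {γ : E → E →L[ℝ] E →L[ℝ] E} {U : Set E} {F : E → E'} (hG : IsLeviCivita G Γ Ω)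
    (hh : IsLeviCivita h γ U) (hF : ContDiffOn ℝ ∞ F U) (hFU : Set.MapsTo F U Ω)
    (hind : ∀ q ∈ U, ∀ u v, h q u v = G (F q) (fderiv ℝ F q u) (fderiv ℝ F q v))
    {q : E} (hq : q ∈ U) (u v w : E) :
    G (F q) (connDeriv Γ F (fun z => fderiv ℝ F z v) q u) (fderiv ℝ F q w) = h q (γ q u v) w := by
  have hFd := differentiableAt_of_contDiffOn hF hh.isOpen hq
  have hFd' := differentiableAt_of_contDiffOn (hF.fderiv_of_isOpen hh.isOpen (m := ∞) le_rfl)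
    hh.isOpen hq
  have hhd := differentiableAt_of_contDiffOn hh.metric_contDiffOn hh.isOpen hq
  set T : E → E → E → ℝ := fun u v w =>
    G (F q) (connDeriv Γ F (fun z => fderiv ℝ F z v) q u) (fderiv ℝ F q w) - h q (γ q u v) w with hT
  have h1 : ∀ u v w, T u v w + T u w v = 0 := by
    intro u v w
    have e1 : (fun z => h z v w) =ᶠ[nhds q]
        fun z => G (F z) (fderiv ℝ F z v) (fderiv ℝ F z w) := by
      filter_upwards [hh.isOpen.mem_nhds hq] with z hz using hind z hz v w
    have e2 : fderiv ℝ (fun z => h z v w) q u = fderiv ℝ h q u v w := by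
      rw [fderiv_clm_apply (hhd.clm_apply (differentiableAt_const _)) (differentiableAt_const _),
        fderiv_clm_apply hhd (differentiableAt_const _)]
      simp
    rw [e1.fderiv_eq, hG.fderiv_form (hFU hq) hFd (hFd'.clm_apply (differentiableAt_const _))
      (hFd'.clm_apply (differentiableAt_const _)), hh.compat q hq,
      hG.symm _ (hFU hq) (fderiv ℝ F q v), hh.symm q hq v] at e2
    simp only [hT]
    linarith
  have h2 : ∀ u v w, T u v w = T v u w := by
    intro u v w
    simp only [hT]
    rw [hG.connDeriv_fderiv_symm hh.isOpen hF hq (hFU hq) u v, hh.torsion q hq u v]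
  -- `T` is symmetric in its first two arguments and skew in its last two. A trilinear expression
  -- with both symmetries vanishes, which is the argument for uniqueness of the Levi-Civita
  -- connection.
  have : T u v w = 0 := by
    linarith [h1 u v w, h1 v u w, h1 w u v, h2 u v w, h2 v w u, h2 u w v]
  simpa [hT, sub_eq_zero] using this

/-- Covariant derivatives are natural under local isometries of the target. -/
lemma IsLeviCivita.connDeriv_isometry {G' : E'' → E'' →L[ℝ] E'' →L[ℝ] ℝ}
    {Γ' : E'' → E'' →L[ℝ] E'' →L[ℝ] E''} {Ω' : Set E''}
    (hG : IsLeviCivita G Γ Ω) (hG' : IsLeviCivita G' Γ' Ω') {θ : E' → E''}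
    (hθ : ContDiffOn ℝ ∞ θ Ω) (hθΩ : Set.MapsTo θ Ω Ω')
    (hsurj : ∀ y ∈ Ω, Function.Surjective (fderiv ℝ θ y))
    (hiso : ∀ y ∈ Ω, ∀ u v, G y u v = G' (θ y) (fderiv ℝ θ y u) (fderiv ℝ θ y v))
    {F V : E → E'} {q : E} (hF : DifferentiableAt ℝ F q) (hV : DifferentiableAt ℝ V q)
    (hq : F q ∈ Ω) (u : E) :
    connDeriv Γ' (fun z => θ (F z)) (fun z => fderiv ℝ θ (F z) (V z)) q u
      = fderiv ℝ θ (F q) (connDeriv Γ F V q u) := by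
  have hθd := differentiableAt_of_contDiffOn hθ hG.isOpen hq
  have hθd' := differentiableAt_of_contDiffOn (hθ.fderiv_of_isOpen hG.isOpen (m := ∞) le_rfl)
    hG.isOpen hq
  -- The transformation law of Christoffel symbols. It is the tangential Gauss formula applied to
  -- the isometry `θ`: its derivative is onto, so there is no normal part.
  have key : ∀ a b, fderiv ℝ θ (F q) (Γ (F q) a b) = fderiv ℝ (fderiv ℝ θ) (F q) a b
      + Γ' (θ (F q)) (fderiv ℝ θ (F q) a) (fderiv ℝ θ (F q) b) := by
    intro a b
    refine (sub_eq_zero.1 (hG'.nondegenerate _ (hθΩ hq) _ fun w => ?_)).symm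
    obtain ⟨w, rfl⟩ := hsurj _ hq w
    rw [map_sub, sub_apply, ← hiso _ hq, ← hG'.form_connDeriv_fderiv hG hθ hθΩ hiso hq, connDeriv,
      fderiv_fderiv_apply hG.isOpen hθ hq, sub_self]
  have h1 : fderiv ℝ (fun z => θ (F z)) q = (fderiv ℝ θ (F q)).comp (fderiv ℝ F q) :=
    fderiv_comp q hθd hF
  have h2 : fderiv ℝ (fun z => fderiv ℝ θ (F z)) q
      = (fderiv ℝ (fderiv ℝ θ) (F q)).comp (fderiv ℝ F q) := fderiv_comp q hθd' hF
  have hc : DifferentiableAt ℝ (fun z => fderiv ℝ θ (F z)) q := hθd'.comp q hF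
  simp only [connDeriv]
  rw [fderiv_clm_apply hc hV, h1, h2]
  simp only [add_apply, ContinuousLinearMap.comp_apply, ContinuousLinearMap.flip_apply, map_add,
    key]
  abel

/-- Covariant derivatives are natural under maps of the source. -/
lemma connDeriv_comp {F V : E' → E''} {Γ' : E'' → E'' →L[ℝ] E'' →L[ℝ] E''} {κ : E → E'} {q : E}
    (hκ : DifferentiableAt ℝ κ q) (hF : DifferentiableAt ℝ F (κ q))
    (hV : DifferentiableAt ℝ V (κ q)) (u : E) :
    connDeriv Γ' (fun z => F (κ z)) (fun z => V (κ z)) q u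
      = connDeriv Γ' F V (κ q) (fderiv ℝ κ q u) := by
  have h1 : fderiv ℝ (fun z => F (κ z)) q = (fderiv ℝ F (κ q)).comp (fderiv ℝ κ q) :=
    fderiv_comp q hF hκ
  have h2 : fderiv ℝ (fun z => V (κ z)) q = (fderiv ℝ V (κ q)).comp (fderiv ℝ κ q) :=
    fderiv_comp q hV hκ
  simp only [connDeriv, h1, h2, ContinuousLinearMap.comp_apply]

end Connection
-- Gauss, Weingarten and Codazzi equations of a hypersurface.
section Hypersurface

variable {E E' : Type*} [NormedAddCommGroup E] [NormedSpace ℝ E]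
  [NormedAddCommGroup E'] [NormedSpace ℝ E']

/-- `F` is an isometric immersion of codimension one, with unit normal field `ξ` and shape
operator `A`, of an open set with metric `h` into an open set with metric `G`. -/
structure IsHypersurface (h : E → E →L[ℝ] E →L[ℝ] ℝ) (γ : E → E →L[ℝ] E →L[ℝ] E) (U : Set E)
    (G : E' → E' →L[ℝ] E' →L[ℝ] ℝ) (Γ : E' → E' →L[ℝ] E' →L[ℝ] E') (Ω : Set E')
    (F ξ : E → E') (ε : ℝ) (A : E → E →L[ℝ] E) : Prop where
  source : IsLeviCivita h γ U
  target : IsLeviCivita G Γ Ω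
  mapsTo : Set.MapsTo F U Ω
  map_contDiffOn : ContDiffOn ℝ ∞ F U
  normal_contDiffOn : ContDiffOn ℝ ∞ ξ U
  induced : ∀ q ∈ U, ∀ u v, h q u v = G (F q) (fderiv ℝ F q u) (fderiv ℝ F q v)
  normal : ∀ q ∈ U, ∀ v, G (F q) (ξ q) (fderiv ℝ F q v) = 0
  unit : ∀ q ∈ U, G (F q) (ξ q) (ξ q) = ε
  eps_mul_eps : ε * ε = 1
  codim : ∀ q ∈ U, ∀ Z, (∀ v, G (F q) Z (fderiv ℝ F q v) = 0) → G (F q) Z (ξ q) = 0 → Z = 0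
  shape_contDiffOn : ContDiffOn ℝ ∞ A U
  shape : ∀ q ∈ U, ∀ u v, h q (A q u) v = - G (F q) (connDeriv Γ F ξ q u) (fderiv ℝ F q v)

/-- The covariant derivative `(∇ᵤ A) v` of a field of endomorphisms. -/
noncomputable def covShape (γ : E → E →L[ℝ] E →L[ℝ] E) (A : E → E →L[ℝ] E) (q u v : E) : E :=
  fderiv ℝ A q u v + γ q u (A q v) - A q (γ q u v)

variable {h : E → E →L[ℝ] E →L[ℝ] ℝ} {γ : E → E →L[ℝ] E →L[ℝ] E} {U : Set E}
    {G : E' → E' →L[ℝ] E' →L[ℝ] ℝ} {Γ : E' → E' →L[ℝ] E' →L[ℝ] E'} {Ω : Set E'}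
    {F ξ : E → E'} {ε : ℝ} {A : E → E →L[ℝ] E}

namespace IsHypersurface

variable (S : IsHypersurface h γ U G Γ Ω F ξ ε A) {q : E} (hq : q ∈ U)
include S hq

lemma differentiableAt_map : DifferentiableAt ℝ F q :=
  differentiableAt_of_contDiffOn S.map_contDiffOn S.source.isOpen hq

lemma differentiableAt_normal : DifferentiableAt ℝ ξ q :=
  differentiableAt_of_contDiffOn S.normal_contDiffOn S.source.isOpen hq

lemma differentiableAt_shape : DifferentiableAt ℝ A q :=
  differentiableAt_of_contDiffOn S.shape_contDiffOn S.source.isOpen hq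

lemma differentiableAt_fderiv : DifferentiableAt ℝ (fderiv ℝ F) q :=
  differentiableAt_of_contDiffOn
    (S.map_contDiffOn.fderiv_of_isOpen S.source.isOpen (m := ∞) le_rfl) S.source.isOpen hq

lemma fderiv_injective {u : E} (hu : fderiv ℝ F q u = 0) : u = 0 := by
  refine S.source.nondegenerate q hq u fun v => ?_
  rw [S.induced q hq, hu, map_zero, zero_apply]

lemma normal' (v : E) : G (F q) (fderiv ℝ F q v) (ξ q) = 0 := by
  rw [S.target.symm _ (S.mapsTo hq), S.normal q hq]

/-- The tangential part is the definition of `A`. The normal part vanishes because `⟨ξ, ξ⟩ = ε` is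
constant. -/
lemma weingarten (u : E) : connDeriv Γ F ξ q u = - fderiv ℝ F q (A q u) := by
  rw [← sub_eq_zero, sub_neg_eq_add]
  refine S.codim q hq _ (fun v => ?_) ?_
  · rw [map_add, add_apply, ← S.induced q hq, S.shape q hq]
    ring
  · rw [map_add, add_apply, S.normal' hq, add_zero]
    have e : (fun z => G (F z) (ξ z) (ξ z)) =ᶠ[nhds q] fun _ => ε := by
      filter_upwards [S.source.isOpen.mem_nhds hq] with z hz using S.unit z hz
    have := S.target.fderiv_form (S.mapsTo hq) (S.differentiableAt_map hq)
      (S.differentiableAt_normal hq) (S.differentiableAt_normal hq) u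
    rw [e.fderiv_eq, S.target.symm _ (S.mapsTo hq) (ξ q)] at this
    simp at this
    linarith

/-- Differentiate `⟨ξ, F_* v⟩ = 0`. -/
lemma form_connDeriv_normal (u v : E) :
    G (F q) (connDeriv Γ F (fun z => fderiv ℝ F z v) q u) (ξ q) = h q (A q u) v := by
  have e : (fun z => G (F z) (ξ z) (fderiv ℝ F z v)) =ᶠ[nhds q] fun _ => 0 := by
    filter_upwards [S.source.isOpen.mem_nhds hq] with z hz using S.normal z hz v
  have := S.target.fderiv_form (S.mapsTo hq) (S.differentiableAt_map hq)
    (S.differentiableAt_normal hq)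
    ((S.differentiableAt_fderiv hq).clm_apply (differentiableAt_const v)) u
  rw [e.fderiv_eq, S.target.symm _ (S.mapsTo hq) (ξ q)] at this
  rw [S.shape q hq]
  simp at this
  linarith

/-- The Gauss formula. -/
lemma gauss (u v : E) : connDeriv Γ F (fun z => fderiv ℝ F z v) q u
    = fderiv ℝ F q (γ q u v) + (ε * h q (A q u) v) • ξ q := by
  rw [← sub_eq_zero]
  refine S.codim q hq _ (fun w => ?_) ?_
  · simp only [map_sub, map_add, map_smul, sub_apply, add_apply, smul_apply]
    rw [S.target.form_connDeriv_fderiv S.source S.map_contDiffOn S.mapsTo S.induced hq,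
      ← S.induced q hq, S.normal q hq]
    simp
  · simp only [map_sub, map_add, map_smul, sub_apply, add_apply, smul_apply]
    rw [S.form_connDeriv_normal hq, S.normal' hq, S.unit q hq]
    -- The coefficient `ε` in the Gauss formula divides by `⟨ξ, ξ⟩ = ε`, since `ε² = 1`.
    linear_combination (-h q (A q u) v) * S.eps_mul_eps

lemma gauss_field {W : E → E} (hW : DifferentiableAt ℝ W q) (u : E) :
    connDeriv Γ F (fun z => fderiv ℝ F z (W z)) q u
      = fderiv ℝ F q (fderiv ℝ W q u + γ q u (W q)) + (ε * h q (A q u) (W q)) • ξ q := by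
  have h1 := S.gauss hq u (W q)
  rw [connDeriv, fderiv_fderiv_apply S.source.isOpen S.map_contDiffOn hq] at h1
  rw [map_add, add_assoc, ← h1, connDeriv, fderiv_clm_apply (S.differentiableAt_fderiv hq) hW]
  simp only [add_apply, ContinuousLinearMap.comp_apply, ContinuousLinearMap.flip_apply]
  abel

lemma shape_symm (u v : E) : h q (A q u) v = h q u (A q v) := by
  rw [S.source.symm q hq u, ← S.form_connDeriv_normal hq, ← S.form_connDeriv_normal hq,
    S.target.connDeriv_fderiv_symm S.source.isOpen S.map_contDiffOn hq (S.mapsTo hq)]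

/-- Differentiate the self-adjointness of `A` in the direction `w`. Since `∇h = 0`, what remains is
self-adjointness of `∇_w A`. -/
lemma covShape_symm (w u v : E) :
    h q (covShape γ A q w u) v = h q u (covShape γ A q w v) := by
  have hh := differentiableAt_of_contDiffOn S.source.metric_contDiffOn S.source.isOpen hq
  have hA := S.differentiableAt_shape hq
  have e : (fun z => h z (A z u) v) =ᶠ[nhds q] fun z => h z u (A z v) := by
    filter_upwards [S.source.isOpen.mem_nhds hq] with z hz using S.shape_symm hz u v
  have : fderiv ℝ (fun z => h z (A z u) v) q w = fderiv ℝ (fun z => h z u (A z v)) q w := by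
    rw [e.fderiv_eq]
  rw [fderiv_clm_apply (hh.clm_apply (hA.clm_apply (differentiableAt_const _)))
    (differentiableAt_const _), fderiv_clm_apply hh (hA.clm_apply (differentiableAt_const _)),
    fderiv_clm_apply hA (differentiableAt_const _),
    fderiv_clm_apply (hh.clm_apply (differentiableAt_const _))
      (hA.clm_apply (differentiableAt_const _)), fderiv_clm_apply hh (differentiableAt_const _),
    fderiv_clm_apply hA (differentiableAt_const _)] at this
  simp only [fderiv_fun_const, Pi.zero_apply, add_apply, ContinuousLinearMap.comp_apply,
    ContinuousLinearMap.flip_apply, map_zero, zero_apply, zero_add,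
    S.source.compat q hq] at this
  simp only [covShape, map_add, map_sub, add_apply, sub_apply]
  rw [S.shape_symm hq (γ q w u), ← S.shape_symm hq u (γ q w v)]
  linarith

lemma connDeriv_connDeriv_normal (u v : E) :
    connDeriv Γ F (fun z => connDeriv Γ F ξ z v) q u
      = - (fderiv ℝ F q (covShape γ A q u v + A q (γ q u v))
        + (ε * h q (A q u) (A q v)) • ξ q) := by
  have e : (fun z => connDeriv Γ F ξ z v) =ᶠ[nhds q] fun z => - fderiv ℝ F z (A z v) := by
    filter_upwards [S.source.isOpen.mem_nhds hq] with z hz using S.weingarten hz v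
  have hA := S.differentiableAt_shape hq
  rw [connDeriv_congr e, connDeriv_neg, S.gauss_field hq (hA.clm_apply (differentiableAt_const _)),
    fderiv_clm_apply hA (differentiableAt_const _)]
  simp [covShape]

/-- The Codazzi equation in a space of constant curvature. -/
lemma codazzi {c : ℝ} (hc : ∀ y ∈ Ω, ∀ u v w,
    connCurvature Γ y u v w = c • (G y v w • u - G y u w • v)) (u v : E) :
    covShape γ A q u v = covShape γ A q v u := by
  -- Apply the commutation formula to `ξ`. The curvature term `c(⟨v, ξ⟩u - ⟨u, ξ⟩v)` is zero because
  -- `ξ` is normal, and the tangential part of the left side is the skew part of `∇A` up to sign.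
  have h1 := connDeriv_comm S.target.isOpen S.target.conn_contDiffOn S.source.isOpen
    S.map_contDiffOn S.mapsTo S.normal_contDiffOn hq u v
  rw [hc _ (S.mapsTo hq), S.normal' hq, S.normal' hq, S.connDeriv_connDeriv_normal hq,
    S.connDeriv_connDeriv_normal hq, S.source.torsion q hq v u, S.source.symm q hq (A q v)] at h1
  apply sub_eq_zero.1
  apply S.fderiv_injective hq
  simp only [zero_smul, sub_zero, smul_zero, map_add] at h1
  rw [map_sub, ← neg_eq_zero, ← h1]
  abel

/-- The second covariant derivative of a normal vector field. -/
lemma secondDeriv_normal {f : E → ℝ} (hf : ContDiffOn ℝ ∞ f U) (u v : E) :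
    connDeriv Γ F (fun z => connDeriv Γ F (fun z => f z • ξ z) z v) q u
      - connDeriv Γ F (fun z => f z • ξ z) q (γ q u v)
      = (fderiv ℝ (fderiv ℝ f) q u v - fderiv ℝ f q (γ q u v)
          - f q * (ε * h q (A q u) (A q v))) • ξ q
        - fderiv ℝ F q (fderiv ℝ f q v • A q u + fderiv ℝ f q u • A q v
          + f q • covShape γ A q u v) := by
  have hfd : ∀ {z}, z ∈ U → DifferentiableAt ℝ f z := fun hz =>
    differentiableAt_of_contDiffOn hf S.source.isOpen hz
  have hfd' : DifferentiableAt ℝ (fun z => fderiv ℝ f z v) q :=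
    (differentiableAt_of_contDiffOn (hf.fderiv_of_isOpen S.source.isOpen (m := ∞) le_rfl)
      S.source.isOpen hq).clm_apply (differentiableAt_const _)
  have hDξ : DifferentiableAt ℝ (fun z => connDeriv Γ F ξ z v) q :=
    differentiableAt_of_contDiffOn (contDiffOn_connDeriv S.source.isOpen
      S.target.conn_contDiffOn S.map_contDiffOn S.mapsTo S.normal_contDiffOn v) S.source.isOpen hq
  have e : (fun z => connDeriv Γ F (fun z => f z • ξ z) z v) =ᶠ[nhds q]
      fun z => fderiv ℝ f z v • ξ z + f z • connDeriv Γ F ξ z v := by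
    filter_upwards [S.source.isOpen.mem_nhds hq] with z hz
    exact connDeriv_smul (hfd hz) (S.differentiableAt_normal hz) v
  have hξ := S.differentiableAt_normal hq
  rw [connDeriv_congr e, connDeriv_add (hfd'.fun_smul hξ) ((hfd hq).fun_smul hDξ),
    connDeriv_smul hfd' hξ, connDeriv_smul (hfd hq) hDξ, connDeriv_smul (hfd hq) hξ,
    S.connDeriv_connDeriv_normal hq, S.weingarten hq, S.weingarten hq, S.weingarten hq,
    fderiv_fderiv_apply S.source.isOpen hf hq]
  simp only [map_add, map_smul, smul_add, smul_neg, sub_smul, smul_smul]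
  abel

end IsHypersurface

end Hypersurface
-- Endomorphisms with a single complex eigenvalue.
section SingleEigenvalue

/-- The characteristic polynomial splits over `ℂ`, hence equals `(X - μ)ⁿ`. Then `nμ` is the trace
of a real matrix, so `μ` is real, and Cayley–Hamilton gives `(M - μ)ⁿ = 0`. -/
lemma exists_isNilpotent_sub_of_charpoly_roots {n : ℕ} [NeZero n] {M : Matrix (Fin n) (Fin n) ℝ}
    {μ : ℂ} (hμ : {z | ((M.map (algebraMap ℝ ℂ)).charpoly).IsRoot z} = {μ}) :
    ∃ a : ℝ, IsNilpotent (M - a • (1 : Matrix (Fin n) (Fin n) ℝ)) := by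
  set P := (M.map (algebraMap ℝ ℂ)).charpoly with hP
  have hmon : P.Monic := Matrix.charpoly_monic _
  have hdeg : P.natDegree = n := by simp [hP, Matrix.charpoly_natDegree_eq_dim]
  have hsplit : P.Splits := IsAlgClosed.splits P
  have hroots : P.roots = Multiset.replicate n μ := by
    rw [Multiset.eq_replicate]
    refine ⟨by rw [← hdeg]; exact hsplit.natDegree_eq_card_roots.symm, fun z hz => ?_⟩
    have : z ∈ {z | P.IsRoot z} := (Polynomial.mem_roots'.1 hz).2
    rw [hμ] at this
    exact this
  have hfac : P = (Polynomial.X - Polynomial.C μ) ^ n := by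
    have := hsplit.eq_prod_roots_of_monic hmon
    rw [hroots] at this
    simpa using this
  have htr : (M.map (algebraMap ℝ ℂ)).trace = n * μ := by
    rw [Matrix.trace_eq_sum_roots_charpoly, ← hP, hroots]
    simp
  have hn : (n : ℂ) ≠ 0 := Nat.cast_ne_zero.2 (NeZero.ne n)
  obtain ⟨a, rfl⟩ : ∃ a : ℝ, (a : ℂ) = μ := by
    refine ⟨M.trace / n, ?_⟩
    have h2 : (M.map (algebraMap ℝ ℂ)).trace = ((M.trace : ℝ) : ℂ) := by
      simp [Matrix.trace]
    rw [h2] at htr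
    push_cast
    rw [htr]
    field_simp
  refine ⟨a, n, ?_⟩
  have hCH := Matrix.aeval_self_charpoly (M.map (algebraMap ℝ ℂ))
  rw [← hP, hfac] at hCH
  simp only [map_pow, map_sub, Polynomial.aeval_X, Polynomial.aeval_C] at hCH
  have hinj : Function.Injective ((algebraMap ℝ ℂ).mapMatrix (m := Fin n)) :=
    Matrix.map_injective (algebraMap ℝ ℂ).injective
  apply hinj
  rw [map_pow, map_zero, map_sub, ← hCH]
  congr 2
  ext i j
  by_cases hij : i = j <;> simp [Matrix.algebraMap_matrix_apply, hij]

/-- Write `M = a + T`. Both `T` and `T²` are nilpotent, so they have trace zero. -/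
lemma trace_of_isNilpotent_sub {n : ℕ} {M : Matrix (Fin n) (Fin n) ℝ} {a : ℝ}
    (h : IsNilpotent (M - a • (1 : Matrix (Fin n) (Fin n) ℝ))) :
    M.trace = n * a ∧ (M * M).trace = n * a ^ 2 := by
  set T := M - a • (1 : Matrix (Fin n) (Fin n) ℝ) with hT
  have hM : M = T + a • (1 : Matrix (Fin n) (Fin n) ℝ) := by simp [hT]
  have h1 : T.trace = 0 := (Matrix.isNilpotent_trace_of_isNilpotent h).eq_zero
  have h2 : (T * T).trace = 0 :=
    (Matrix.isNilpotent_trace_of_isNilpotent ((Commute.refl T).isNilpotent_mul_left h)).eq_zero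
  rw [hM]
  constructor
  · simp [Matrix.trace_add, h1, mul_comm]
  · simp only [add_mul, mul_add, Matrix.trace_add, h2, Matrix.mul_smul, Matrix.smul_mul,
      Matrix.trace_smul, mul_one, one_mul, h1, Matrix.trace_one, Fintype.card_fin, smul_eq_mul]
    ring

/-- A linear form which is an eigenvector of the transpose of `A`, but not for the only
eigenvalue of `A`, vanishes. -/
lemma eq_zero_of_isNilpotent_sub {E : Type*} [NormedAddCommGroup E] [NormedSpace ℝ E]
    {A : E →L[ℝ] E} {a b : ℝ} (hA : IsNilpotent (A - a • (1 : E →L[ℝ] E)))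
    (hab : a ≠ b) {L : E →L[ℝ] ℝ} (hL : ∀ w, L (A w) = b * L w) : L = 0 := by
  obtain ⟨k, hk⟩ := hA
  -- `L` is an eigencovector of `A - a` for `b - a ≠ 0`, hence of every power. Some power is zero,
  -- which forces `L = 0`.
  have h : ∀ k w, L (((A - a • (1 : E →L[ℝ] E)) ^ k) w) = (b - a) ^ k * L w := by
    intro k
    induction k with
    | zero => simp
    | succ k ih =>
      intro w
      rw [pow_succ, mul_apply_eq_comp, ih]
      simp [hL]
      ring
  ext w
  have := h k w
  rw [hk] at this
  simpa [sub_ne_zero.2 hab.symm] using this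

end SingleEigenvalue

/-! ### Tangential and normal parts of the Laplacian of `f ξ`. -/

section Contraction

variable {m : ℕ} {E' : Type*} [NormedAddCommGroup E'] [NormedSpace ℝ E']
  {h : Coord m → CoordForm m} {γ : Coord m → Coord m →L[ℝ] Coord m →L[ℝ] Coord m}
  {U : Set (Coord m)}
  {G : E' → E' →L[ℝ] E' →L[ℝ] ℝ} {Γ : E' → E' →L[ℝ] E' →L[ℝ] E'} {Ω : Set E'}
  {F ξ : Coord m → E'} {ε : ℝ} {A : Coord m → Coord m →L[ℝ] Coord m}

/-- The Laplace operator on vector fields along `F`. -/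
noncomputable def connLaplacian (h : Coord m → CoordForm m)
    (γ : Coord m → Coord m →L[ℝ] Coord m →L[ℝ] Coord m) (Γ : E' → E' →L[ℝ] E' →L[ℝ] E')
    (F V : Coord m → E') (q : Coord m) : E' :=
  - ∑ i, ∑ j, (gram (h q))⁻¹ i j • (connDeriv Γ F (fun z => connDeriv Γ F V z (basisVec j)) q
    (basisVec i) - connDeriv Γ F V q (γ q (basisVec i) (basisVec j)))

lemma sum_gram_inv_linear {B : CoordForm m} (hs : ∀ u v, B u v = B v u)
    (hB : ∀ u, (∀ v, B u v = 0) → u = 0) (a : Coord m →L[ℝ] ℝ) (w : Coord m) :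
    ∑ i, ∑ j, (gram B)⁻¹ i j * (a (basisVec j) * B (basisVec i) w) = a w := by
  rw [← form_sharp hs hB a w]
  simp [mul_assoc]

lemma gram_inv_symm {B : CoordForm m} (hs : ∀ u v, B u v = B v u) (i j : Fin m) :
    (gram B)⁻¹ i j = (gram B)⁻¹ j i := by
  have : (gram B).transpose = gram B := by
    ext i j
    exact hs _ _
  conv_lhs => rw [← this, ← Matrix.transpose_nonsing_inv, Matrix.transpose_apply]

namespace IsHypersurface

variable (S : IsHypersurface h γ U G Γ Ω F ξ ε A) {q : Coord m} (hq : q ∈ U)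
include S hq

/-- The metric trace of the Codazzi equation. -/
lemma sum_covShape {c : ℝ} (hc : ∀ y ∈ Ω, ∀ u v w,
    connCurvature Γ y u v w = c • (G y v w • u - G y u w • v)) (w : Coord m) :
    ∑ i, ∑ j, (gram (h q))⁻¹ i j * h q (covShape γ A q (basisVec i) (basisVec j)) w
      = fderiv ℝ (fun z => ∑ i, A z (basisVec i) i) q w := by
  have hA := S.differentiableAt_shape hq
  have hproj : ∀ i, fderiv ℝ (fun z => A z (basisVec i) i) q w
      = fderiv ℝ A q w (basisVec i) i := by
    intro i
    have h1 : DifferentiableAt ℝ (fun z => A z (basisVec i)) q :=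
      hA.clm_apply (differentiableAt_const _)
    have h2 := ((EuclideanSpace.proj (𝕜 := ℝ) i).hasFDerivAt.comp q h1.hasFDerivAt).fderiv
    have h3 : (fun z => A z (basisVec i) i)
      = (EuclideanSpace.proj (𝕜 := ℝ) i) ∘ fun z => A z (basisVec i) := rfl
    rw [h3, h2, fderiv_clm_apply hA (differentiableAt_const _)]
    simp
  have hdiff : ∀ i, DifferentiableAt ℝ (fun z => A z (basisVec i) i) q := fun i =>
    (EuclideanSpace.proj (𝕜 := ℝ) i).differentiableAt.comp q
      (hA.clm_apply (differentiableAt_const (basisVec i)))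
  rw [fderiv_fun_sum fun i _ => hdiff i, sum_apply]
  simp only [hproj]
  have e := sum_gram_inv_form (S.source.symm q hq) (S.source.nondegenerate q hq)
    (fderiv ℝ A q w + (γ q w).comp (A q) - (A q).comp (γ q w))
  have e2 := trace_comp_comm (γ q w) (A q)
  calc _ = ∑ i, ∑ j, (gram (h q))⁻¹ i j * h q ((fderiv ℝ A q w + (γ q w).comp (A q)
        - (A q).comp (γ q w)) (basisVec i)) (basisVec j) := by
        refine Finset.sum_congr rfl fun i _ => Finset.sum_congr rfl fun j _ => ?_
        -- Self-adjointness of `∇ᵢA` and Codazzi move `w` into the direction of differentiation: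
        -- `h((∇ᵢA)∂ⱼ, w) = h((∇_w A)∂ᵢ, ∂ⱼ)`. The metric trace is then the ordinary trace of `∇_w
        -- A`, whose commutator part `[γ_w, A]` has trace zero.
        rw [S.covShape_symm hq, S.source.symm q hq, S.codazzi hq hc (basisVec i) w]
        rfl
    _ = _ := by
        rw [e]
        simp only [add_apply, sub_apply, ContinuousLinearMap.comp_apply, PiLp.add_apply,
          PiLp.sub_apply, Finset.sum_add_distrib, Finset.sum_sub_distrib, e2]
        ring

/-- The tangential part of the Laplacian of a normal vector field. -/
lemma form_connLaplacian_tangent {c : ℝ} (hc : ∀ y ∈ Ω, ∀ u v w,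
    connCurvature Γ y u v w = c • (G y v w • u - G y u w • v)) {f : Coord m → ℝ}
    (hf : ContDiffOn ℝ ∞ f U) (w : Coord m) :
    G (F q) (connLaplacian h γ Γ F (fun z => f z • ξ z) q) (fderiv ℝ F q w)
      = 2 * fderiv ℝ f q (A q w) + f q * fderiv ℝ (fun z => ∑ i, A z (basisVec i) i) q w := by
  rw [← S.sum_covShape hq hc]
  have hs := S.source.symm q hq
  have e := sum_gram_inv_linear hs (S.source.nondegenerate q hq) (fderiv ℝ f q) (A q w)
  -- The second derivative of `f ξ` has the cross terms `df(∂ⱼ) A∂ᵢ` and `df(∂ᵢ) A∂ⱼ`. Each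
  -- contributes one `df(Aw)`, hence the factor 2.
  have e' : ∑ i, ∑ j, (gram (h q))⁻¹ i j * (fderiv ℝ f q (basisVec i) *
      h q (basisVec j) (A q w)) = fderiv ℝ f q (A q w) := by
    rw [← e, Finset.sum_comm]
    refine Finset.sum_congr rfl fun i _ => Finset.sum_congr rfl fun j _ => ?_
    rw [gram_inv_symm hs]
  simp only [connLaplacian, S.secondDeriv_normal hq hf, map_neg, map_sum, map_smul, map_sub,
    neg_apply, sum_apply, smul_apply, sub_apply, S.normal q hq, smul_eq_mul, mul_zero, zero_sub,
    ← S.induced q hq, map_add, add_apply, S.shape_symm hq]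
  conv_rhs => rw [two_mul]
  nth_rewrite 1 [← e]
  rw [← e']
  simp only [Finset.mul_sum, ← Finset.sum_add_distrib, ← Finset.sum_neg_distrib]
  refine Finset.sum_congr rfl fun i _ => Finset.sum_congr rfl fun j _ => ?_
  ring

/-- The normal part of the Laplacian of a normal vector field of constant length. -/
lemma form_connLaplacian_normal {f : Coord m → ℝ} (hf : ContDiffOn ℝ ∞ f U)
    (hf0 : ∀ᶠ z in nhds q, fderiv ℝ f z = 0) :
    G (F q) (connLaplacian h γ Γ F (fun z => f z • ξ z) q) (ξ q)
      = f q * ∑ i, A q (A q (basisVec i)) i := by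
  have hs := S.source.symm q hq
  have e := sum_gram_inv_form hs (S.source.nondegenerate q hq) ((A q).comp (A q))
  have h2 : fderiv ℝ (fderiv ℝ f) q = 0 := by
    have : fderiv ℝ f =ᶠ[nhds q] fun _ => 0 := hf0
    rw [this.fderiv_eq]
    simp
  simp only [ContinuousLinearMap.comp_apply] at e
  rw [← e]
  simp only [connLaplacian, S.secondDeriv_normal hq hf, map_neg, map_sum, map_smul, map_sub,
    neg_apply, sum_apply, smul_apply, sub_apply, S.unit q hq, smul_eq_mul, S.normal' hq, h2,
    hf0.self_of_nhds, zero_apply]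
  simp only [Finset.mul_sum, ← Finset.sum_neg_distrib]
  refine Finset.sum_congr rfl fun i _ => Finset.sum_congr rfl fun j _ => ?_
  rw [S.shape_symm hq (A q _)]
  linear_combination ((gram (h q))⁻¹ i j * f q * h q (A q (basisVec i)) (A q (basisVec j)))
    * S.eps_mul_eps

end IsHypersurface

end Contraction
-- Hypersurfaces in coordinates, with Christoffel symbols as connections.
section Coordinates

variable {m n : ℕ}

lemma isLeviCivita_christoffelMap {G : Coord n → CoordForm n} {Ω : Set (Coord n)} (hΩ : IsOpen Ω)
    (hG : ContDiffOn ℝ ∞ G Ω) (hs : ∀ y ∈ Ω, ∀ u v, G y u v = G y v u)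
    (hB : ∀ y ∈ Ω, ∀ u, (∀ v, G y u v = 0) → u = 0) : IsLeviCivita G (christoffelMap G) Ω := by
  have hd : ∀ y ∈ Ω, ∀ w u v, fderiv ℝ G y w u v = fderiv ℝ G y w v u := fun y hy =>
    fderiv_form_symm (differentiableAt_of_contDiffOn hG hΩ hy)
      (by filter_upwards [hΩ.mem_nhds hy] with z hz using hs z hz)
  refine ⟨hΩ, hG, contDiffOn_christoffelMap hΩ hG hB, hs, hB, fun y hy u v => ?_,
    fun y hy w u v => ?_⟩
  · exact christoffel_symm (differentiableAt_of_contDiffOn hG hΩ hy)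
      (by filter_upwards [hΩ.mem_nhds hy] with z hz using hs z hz) u v
  · rw [hs y hy u, christoffelMap_apply, christoffelMap_apply,
      form_christoffel (hs y hy) (hB y hy), form_christoffel (hs y hy) (hB y hy),
      hd y hy w v u]
    ring

lemma covDeriv_eq (G : Coord n → CoordForm n) (F V : Coord m → Coord n) (q u : Coord m) :
    covDeriv G F V q u = connDeriv (christoffelMap G) F V q u := rfl

lemma laplacian_eq (h : Coord m → CoordForm m) (G : Coord n → CoordForm n)
    (F V : Coord m → Coord n) (q : Coord m) : laplacian h G F V q
      = connLaplacian h (christoffelMap h) (christoffelMap G) F V q := rfl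

/-- `F` is a hypersurface with unit normal field `ξ` of the open set `Ω` with the metric `G`, and
`h` is its induced metric. -/
structure IsCoordHypersurface (h : Coord m → CoordForm m) (U : Set (Coord m))
    (G : Coord n → CoordForm n) (Ω : Set (Coord n)) (F ξ : Coord m → Coord n) (ε : ℝ) : Prop where
  isOpen_source : IsOpen U
  isOpen_target : IsOpen Ω
  metric_contDiffOn : ContDiffOn ℝ ∞ G Ω
  symm : ∀ y ∈ Ω, ∀ u v, G y u v = G y v u
  nondegenerate : ∀ y ∈ Ω, ∀ u, (∀ v, G y u v = 0) → u = 0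
  mapsTo : Set.MapsTo F U Ω
  map_contDiffOn : ContDiffOn ℝ ∞ F U
  normal_contDiffOn : ContDiffOn ℝ ∞ ξ U
  induced : ∀ q ∈ U, ∀ u v, h q u v = G (F q) (fderiv ℝ F q u) (fderiv ℝ F q v)
  induced_nondegenerate : ∀ q ∈ U, ∀ u, (∀ v, h q u v = 0) → u = 0
  normal : ∀ q ∈ U, ∀ v, G (F q) (ξ q) (fderiv ℝ F q v) = 0
  unit : ∀ q ∈ U, G (F q) (ξ q) (ξ q) = ε

/-- The shape operator of a hypersurface in coordinates, as an endomorphism. -/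
noncomputable def shapeMap (h : Coord m → CoordForm m) (G : Coord n → CoordForm n)
    (F ξ : Coord m → Coord n) (q : Coord m) : Coord m →L[ℝ] Coord m :=
  Matrix.toEuclideanCLM (n := Fin m) (𝕜 := ℝ) (shapeMatrix h G F ξ q)

lemma toEuclideanCLM_basisVec (M : Matrix (Fin m) (Fin m) ℝ) (i j : Fin m) :
    Matrix.toEuclideanCLM (n := Fin m) (𝕜 := ℝ) M (basisVec j) i = M i j := by
  simp [basisVec]

lemma shapeMap_apply (h : Coord m → CoordForm m) (G : Coord n → CoordForm n)
    (F ξ : Coord m → Coord n) (q u : Coord m) : shapeMap h G F ξ q u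
      = ∑ i, ∑ j, ((gram (h q))⁻¹ i j *
          ((-(G (F q) (connDeriv (christoffelMap G) F ξ q u)).comp (fderiv ℝ F q))
            (basisVec j))) • basisVec i := by
  -- `D` is `u ↦ ∇̃ᵤ ξ` as a linear map. With it both sides are linear in `u`, and a comparison on
  -- basis vectors suffices.
  set D : Coord m →L[ℝ] Coord n := fderiv ℝ ξ q +
    ((christoffelMap G (F q)).flip (ξ q)).comp (fderiv ℝ F q) with hD
  have hDu : ∀ u, connDeriv (christoffelMap G) F ξ q u = D u := fun u => rfl
  have key : ∀ u, (∑ i, ∑ j, ((gram (h q))⁻¹ i j *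
          ((-(G (F q) (D u)).comp (fderiv ℝ F q)) (basisVec j))) • (basisVec i : Coord m))
      = (∑ i, ∑ j, (gram (h q))⁻¹ i j • (-(((G (F q)).flip (fderiv ℝ F q (basisVec j))).comp
          D)).smulRight (basisVec i : Coord m)) u := by
    intro u
    simp [smul_smul]
  rw [hDu, key, clm_eq_sum (shapeMap h G F ξ q), clm_eq_sum (∑ i, ∑ j, (gram (h q))⁻¹ i j •
    (-(((G (F q)).flip (fderiv ℝ F q (basisVec j))).comp D)).smulRight (basisVec i : Coord m))]
  refine Finset.sum_congr rfl fun k _ => ?_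
  rw [← key]
  congr 1
  ext i
  rw [shapeMap, toEuclideanCLM_basisVec]
  simp [shapeMatrix, covDeriv_eq, hDu, basisVec, Pi.single_apply]

namespace IsCoordHypersurface

variable {h : Coord m → CoordForm m} {U : Set (Coord m)} {G : Coord n → CoordForm n}
  {Ω : Set (Coord n)} {F ξ : Coord m → Coord n} {ε : ℝ}
  (S : IsCoordHypersurface h U G Ω F ξ ε)
include S

lemma isLeviCivita_target : IsLeviCivita G (christoffelMap G) Ω :=
  isLeviCivita_christoffelMap S.isOpen_target S.metric_contDiffOn S.symm S.nondegenerate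

lemma contDiffOn_fderiv (v : Coord m) : ContDiffOn ℝ ∞ (fun q => fderiv ℝ F q v) U :=
  (S.map_contDiffOn.fderiv_of_isOpen S.isOpen_source (m := ∞) le_rfl).clm_apply contDiffOn_const

lemma contDiffOn_induced : ContDiffOn ℝ ∞ h U := by
  refine contDiffOn_clm_apply.2 fun u => contDiffOn_clm_apply.2 fun v => ?_
  refine ContDiffOn.congr ?_ fun q hq => S.induced q hq u v
  exact ((S.metric_contDiffOn.comp S.map_contDiffOn S.mapsTo).clm_apply
    (S.contDiffOn_fderiv u)).clm_apply (S.contDiffOn_fderiv v)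

lemma isLeviCivita_source : IsLeviCivita h (christoffelMap h) U :=
  isLeviCivita_christoffelMap S.isOpen_source S.contDiffOn_induced
    (fun q hq u v => by rw [S.induced q hq, S.induced q hq, S.symm _ (S.mapsTo hq)])
    S.induced_nondegenerate

lemma contDiffOn_shapeMatrix (i k : Fin m) :
    ContDiffOn ℝ ∞ (fun q => shapeMatrix h G F ξ q i k) U := by
  simp only [shapeMatrix, Matrix.of_apply]
  refine ContDiffOn.sum fun j _ =>
    (contDiffOn_gram_inv S.contDiffOn_induced S.induced_nondegenerate i j).mul ?_
  refine ((S.metric_contDiffOn.comp S.map_contDiffOn S.mapsTo).clm_apply ?_).clm_apply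
    (S.contDiffOn_fderiv _)
  exact (contDiffOn_connDeriv S.isOpen_source S.isLeviCivita_target.conn_contDiffOn
    S.map_contDiffOn S.mapsTo S.normal_contDiffOn _).neg

lemma contDiffOn_shapeMap : ContDiffOn ℝ ∞ (shapeMap h G F ξ) U := by
  refine contDiffOn_clm_apply.2 fun u => ?_
  rw [contDiffOn_euclidean]
  intro i
  have : ∀ q, shapeMap h G F ξ q u i = ∑ k, u k * shapeMatrix h G F ξ q i k := by
    intro q
    rw [clm_eq_sum (shapeMap h G F ξ q)]
    simp only [WithLp.ofLp_sum, Finset.sum_apply, PiLp.smul_apply, smul_eq_mul, shapeMap,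
      toEuclideanCLM_basisVec]
  simp only [this]
  exact ContDiffOn.sum fun k _ => contDiffOn_const.mul (S.contDiffOn_shapeMatrix i k)

lemma form_shapeMap {q : Coord m} (hq : q ∈ U) (u v : Coord m) :
    h q (shapeMap h G F ξ q u) v
      = - G (F q) (connDeriv (christoffelMap G) F ξ q u) (fderiv ℝ F q v) := by
  rw [shapeMap_apply, form_sharp (S.isLeviCivita_source.symm q hq) (S.induced_nondegenerate q hq)]
  simp

/-- Nondegeneracy of `h` makes `F_*` injective, and `ε ≠ 0` keeps `ξ` out of its image. By dimension
the two span `ℝⁿ`, so `Z` is orthogonal to everything. -/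
lemma eq_zero_of_orthogonal (hmn : n = m + 1) (hε : ε ≠ 0) {q : Coord m} (hq : q ∈ U)
    {Z : Coord n} (h1 : ∀ v, G (F q) Z (fderiv ℝ F q v) = 0) (h2 : G (F q) Z (ξ q) = 0) :
    Z = 0 := by
  set R : Submodule ℝ (Coord n) := LinearMap.range (fderiv ℝ F q : Coord m →ₗ[ℝ] Coord n) with hR
  have hinj : Function.Injective (fderiv ℝ F q : Coord m →ₗ[ℝ] Coord n) := by
    rw [injective_iff_map_eq_zero]
    intro u hu
    have hu' : fderiv ℝ F q u = 0 := hu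
    refine S.induced_nondegenerate q hq u fun v => ?_
    rw [S.induced q hq, hu', map_zero, zero_apply]
  have hRdim : Module.finrank ℝ R = m := by
    rw [hR, LinearMap.finrank_range_of_inj hinj]
    simp
  have hξ : ξ q ∉ R := by
    rintro ⟨v, hv⟩
    have hv' : fderiv ℝ F q v = ξ q := hv
    apply hε
    rw [← S.unit q hq]
    nth_rewrite 2 [← hv']
    exact S.normal q hq v
  have hlt : R < R ⊔ Submodule.span ℝ {ξ q} := by
    refine lt_of_le_of_ne le_sup_left fun he => hξ ?_
    rw [he]
    exact Submodule.mem_sup_right (Submodule.mem_span_singleton_self _)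
  have htop : R ⊔ Submodule.span ℝ {ξ q} = ⊤ := by
    apply Submodule.eq_top_of_finrank_eq
    have := Submodule.finrank_lt_finrank_of_lt hlt
    have h3 := Submodule.finrank_le (R ⊔ Submodule.span ℝ {ξ q})
    have h4 : Module.finrank ℝ (Coord n) = n := by simp
    omega
  refine S.nondegenerate _ (S.mapsTo hq) Z fun w => ?_
  have hw : w ∈ R ⊔ Submodule.span ℝ {ξ q} := htop ▸ Submodule.mem_top
  obtain ⟨a, ⟨v, rfl⟩, b, hb, rfl⟩ := Submodule.mem_sup.1 hw
  obtain ⟨t, rfl⟩ := Submodule.mem_span_singleton.1 hb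
  have := h1 v
  simp [h2, this]

lemma isHypersurface (hmn : n = m + 1) (hε : ε = 1 ∨ ε = -1) :
    IsHypersurface h (christoffelMap h) U G (christoffelMap G) Ω F ξ ε (shapeMap h G F ξ) where
  source := S.isLeviCivita_source
  target := S.isLeviCivita_target
  mapsTo := S.mapsTo
  map_contDiffOn := S.map_contDiffOn
  normal_contDiffOn := S.normal_contDiffOn
  induced := S.induced
  normal := S.normal
  unit := S.unit
  eps_mul_eps := by rcases hε with rfl | rfl <;> norm_num
  codim := fun q hq Z h1 h2 =>
    S.eq_zero_of_orthogonal hmn (by rcases hε with rfl | rfl <;> norm_num) hq h1 h2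
  shape_contDiffOn := S.contDiffOn_shapeMap
  shape := fun q hq => S.form_shapeMap hq

end IsCoordHypersurface

lemma trace_shapeMap (h : Coord m → CoordForm m) (G : Coord n → CoordForm n)
    (F ξ : Coord m → Coord n) (q : Coord m) :
    ∑ i, shapeMap h G F ξ q (basisVec i) i = (shapeMatrix h G F ξ q).trace := by
  simp [shapeMap, toEuclideanCLM_basisVec, Matrix.trace]

lemma trace_shapeMap_sq (h : Coord m → CoordForm m) (G : Coord n → CoordForm n)
    (F ξ : Coord m → Coord n) (q : Coord m) :
    ∑ i, shapeMap h G F ξ q (shapeMap h G F ξ q (basisVec i)) i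
      = (shapeMatrix h G F ξ q * shapeMatrix h G F ξ q).trace := by
  have : ∀ i, shapeMap h G F ξ q (shapeMap h G F ξ q (basisVec i)) i
      = Matrix.toEuclideanCLM (n := Fin m) (𝕜 := ℝ)
        (shapeMatrix h G F ξ q * shapeMatrix h G F ξ q) (basisVec i) i := by
    intro i
    rw [map_mul]; rfl
  simp only [this, toEuclideanCLM_basisVec, Matrix.trace, Matrix.diag_apply]

/-! ### Consequences of `Δ(f ξ) = λ f ξ` at a point with a single eigenvalue. -/

section Proper

variable {h : Coord 4 → CoordForm 4} {U : Set (Coord 4)} {G : Coord 5 → CoordForm 5}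
  {Ω : Set (Coord 5)} {F ξ : Coord 4 → Coord 5} {ε c lam : ℝ} {f : Coord 4 → ℝ}

/-- At a point where the shape operator has a single eigenvalue, the mean curvature `f` satisfies
`f df = 0`. -/
lemma IsCoordHypersurface.meanCurvature_mul_fderiv (S : IsCoordHypersurface h U G Ω F ξ ε)
    (hε : ε = 1 ∨ ε = -1) (hc : ∀ y ∈ Ω, ∀ u v w,
      curvature G y u v w = c • (G y v w • u - G y u w • v))
    (hf : ∀ q ∈ U, f q = 1 / 4 * ε * (shapeMatrix h G F ξ q).trace)
    {q : Coord 4} (hq : q ∈ U)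
    (hlap : laplacian h G F (fun z => f z • ξ z) q = lam • (f q • ξ q))
    {μ : ℂ} (hμ : {z | ((shapeMatrix h G F ξ q).map (algebraMap ℝ ℂ)).charpoly.IsRoot z} = {μ}) :
    f q = 0 ∨ fderiv ℝ f q = 0 := by
  have H := S.isHypersurface rfl hε
  have hε2 : ε * ε = 1 := H.eps_mul_eps
  obtain ⟨a, ha⟩ := exists_isNilpotent_sub_of_charpoly_roots hμ
  have hfs : ContDiffOn ℝ ∞ f U := by
    refine ContDiffOn.congr ?_ hf
    simp only [Matrix.trace]
    exact contDiffOn_const.mul (ContDiffOn.sum fun i _ => S.contDiffOn_shapeMatrix i i)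
  have hta := (trace_of_isNilpotent_sub ha).1
  have hfa : ε * f q = a := by
    rw [hf q hq, hta]
    push_cast
    linear_combination a * hε2
  by_cases h0 : a = 0
  · left
    rw [h0] at hfa
    linear_combination ε * hfa - f q * hε2
  right
  have htr : ∀ᶠ z in nhds q, ∑ i, shapeMap h G F ξ z (basisVec i) i = 4 * ε * f z := by
    filter_upwards [S.isOpen_source.mem_nhds hq] with z hz
    rw [trace_shapeMap, hf z hz]
    linear_combination (- (shapeMatrix h G F ξ z).trace) * hε2
  have hnil : IsNilpotent (shapeMap h G F ξ q - a • (1 : Coord 4 →L[ℝ] Coord 4)) := by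
    have := ha.map (Matrix.toEuclideanCLM (n := Fin 4) (𝕜 := ℝ))
    rwa [map_sub, map_smul, map_one] at this
  -- With `tr A = 4εf` the tangential equation is `2 df(Aw) + 4εf df(w) = 0`, and `εf = a`. The
  -- values `a` and `-2a` coincide only for `a = 0`.
  refine eq_zero_of_isNilpotent_sub hnil (b := -2 * a) (fun h => h0 (by linarith)) fun w => ?_
  have key := H.form_connLaplacian_tangent hq hc hfs w
  have htr' : (fun z => ∑ i, shapeMap h G F ξ z (basisVec i) i) =ᶠ[nhds q]
      fun z => 4 * ε * f z := htr
  rw [← laplacian_eq, hlap, map_smul, map_smul, smul_apply, smul_apply, S.normal q hq,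
    htr'.fderiv_eq, fderiv_const_mul (differentiableAt_of_contDiffOn hfs S.isOpen_source hq)] at key
  simp only [smul_apply, smul_eq_mul, mul_zero] at key
  linear_combination (-1 / 2) * key - 2 * fderiv ℝ f q w * hfa

/-- At a point near which the mean curvature `f` is constant, `f = 0` or `f² = ε λ / 4`. -/
lemma IsCoordHypersurface.meanCurvature_sq (S : IsCoordHypersurface h U G Ω F ξ ε)
    (hε : ε = 1 ∨ ε = -1)
    (hf : ∀ q ∈ U, f q = 1 / 4 * ε * (shapeMatrix h G F ξ q).trace)
    {q : Coord 4} (hq : q ∈ U)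
    (hlap : laplacian h G F (fun z => f z • ξ z) q = lam • (f q • ξ q))
    {μ : ℂ} (hμ : {z | ((shapeMatrix h G F ξ q).map (algebraMap ℝ ℂ)).charpoly.IsRoot z} = {μ})
    (hf0 : ∀ᶠ z in nhds q, fderiv ℝ f z = 0) :
    f q = 0 ∨ f q ^ 2 = ε * lam / 4 := by
  have H := S.isHypersurface rfl hε
  have hε2 : ε * ε = 1 := H.eps_mul_eps
  obtain ⟨a, ha⟩ := exists_isNilpotent_sub_of_charpoly_roots hμ
  have hfs : ContDiffOn ℝ ∞ f U := by
    refine ContDiffOn.congr ?_ hf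
    simp only [Matrix.trace]
    exact contDiffOn_const.mul (ContDiffOn.sum fun i _ => S.contDiffOn_shapeMatrix i i)
  obtain ⟨hta, hta2⟩ := trace_of_isNilpotent_sub ha
  have hfa : f q = ε * a := by
    rw [hf q hq, hta]
    push_cast
    ring
  rw [or_iff_not_imp_left]
  intro h0
  have key := H.form_connLaplacian_normal hq hfs hf0
  -- The normal equation becomes `λ f ε = f · 4a²`. Cancelling `f ≠ 0` and using `f = εa` gives the
  -- value of `f²`.
  rw [← laplacian_eq, hlap, map_smul, map_smul, smul_apply, smul_apply, S.unit q hq,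
    trace_shapeMap_sq, hta2] at key
  simp only [smul_eq_mul] at key
  push_cast at key
  apply mul_left_cancel₀ h0
  rw [hfa] at key ⊢
  linear_combination (-1 / 4) * key + ε * a ^ 3 * hε2

end Proper

end Coordinates
-- Invariance of the trace of the shape operator.
section ChangeOfCoordinates

lemma IsLeviCivita.mono {E : Type*} [NormedAddCommGroup E] [NormedSpace ℝ E]
    {G : E → E →L[ℝ] E →L[ℝ] ℝ} {Γ : E → E →L[ℝ] E →L[ℝ] E} {Ω Ω₀ : Set E}
    (hG : IsLeviCivita G Γ Ω) (h : IsOpen Ω₀) (hsub : Ω₀ ⊆ Ω) : IsLeviCivita G Γ Ω₀ :=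
  ⟨h, hG.metric_contDiffOn.mono hsub, hG.conn_contDiffOn.mono hsub,
    fun y hy => hG.symm y (hsub hy), fun y hy => hG.nondegenerate y (hsub hy),
    fun y hy => hG.torsion y (hsub hy), fun y hy => hG.compat y (hsub hy)⟩

variable {m n : ℕ} {h h' : Coord m → CoordForm m} {U U' : Set (Coord m)}
  {G G' : Coord n → CoordForm n} {Ω Ω' Ω₀ : Set (Coord n)} {F ξ F' ξ' : Coord m → Coord n} {ε : ℝ}

/-- The mean curvature does not depend on the coordinates. -/
lemma IsCoordHypersurface.trace_shapeMatrix_eq (S : IsCoordHypersurface h U G Ω F ξ ε)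
    (S' : IsCoordHypersurface h' U' G' Ω' F' ξ' ε)
    {θ : Coord n → Coord n} {κ : Coord m → Coord m} (hΩ₀ : IsOpen Ω₀) (hsub : Ω₀ ⊆ Ω)
    (hθ : ContDiffOn ℝ ∞ θ Ω₀) (hθΩ : Set.MapsTo θ Ω₀ Ω')
    (hsurj : ∀ y ∈ Ω₀, Function.Surjective (fderiv ℝ θ y))
    (hiso : ∀ y ∈ Ω₀, ∀ u v, G y u v = G' (θ y) (fderiv ℝ θ y u) (fderiv ℝ θ y v))
    {q : Coord m} (hq : q ∈ U') (hκq : κ q ∈ U) (hFq : F (κ q) ∈ Ω₀) {K : Coord m ≃L[ℝ] Coord m}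
    (hK : HasFDerivAt κ (K : Coord m →L[ℝ] Coord m) q)
    (hF' : F' =ᶠ[nhds q] fun z => θ (F (κ z)))
    (hξ' : ξ' =ᶠ[nhds q] fun z => fderiv ℝ θ (F (κ z)) (ξ (κ z))) :
    (shapeMatrix h' G' F' ξ' q).trace = (shapeMatrix h G F ξ (κ q)).trace := by
  have hFd : DifferentiableAt ℝ F (κ q) :=
    differentiableAt_of_contDiffOn S.map_contDiffOn S.isOpen_source hκq
  have hξd : DifferentiableAt ℝ ξ (κ q) :=
    differentiableAt_of_contDiffOn S.normal_contDiffOn S.isOpen_source hκq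
  have hκd : DifferentiableAt ℝ κ q := hK.differentiableAt
  have hFκd : DifferentiableAt ℝ (fun z => F (κ z)) q := hFd.comp q hκd
  have hξκd : DifferentiableAt ℝ (fun z => ξ (κ z)) q := hξd.comp q hκd
  have hθd := differentiableAt_of_contDiffOn hθ hΩ₀ hFq
  have hdF : ∀ u, fderiv ℝ F' q u = fderiv ℝ θ (F (κ q)) (fderiv ℝ F (κ q) (K u)) := by
    intro u
    have h2 : fderiv ℝ (fun z => F (κ z)) q = (fderiv ℝ F (κ q)).comp (fderiv ℝ κ q) :=
      fderiv_comp q hFd hκd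
    have h1 : fderiv ℝ (fun z => θ (F (κ z))) q
        = (fderiv ℝ θ (F (κ q))).comp (fderiv ℝ (fun z => F (κ z)) q) :=
      fderiv_comp q hθd hFκd
    rw [hF'.fderiv_eq, h1, h2, hK.fderiv]
    rfl
  have hDξ : ∀ u, connDeriv (christoffelMap G') F' ξ' q u
      = fderiv ℝ θ (F (κ q)) (connDeriv (christoffelMap G) F ξ (κ q) (K u)) := by
    intro u
    have e : connDeriv (christoffelMap G') F' ξ' q u = connDeriv (christoffelMap G')
        (fun z => θ (F (κ z))) (fun z => fderiv ℝ θ (F (κ z)) (ξ (κ z))) q u := by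
      simp only [connDeriv, hξ'.fderiv_eq, hF'.fderiv_eq, hξ'.self_of_nhds, hF'.self_of_nhds]
    rw [e, (S.isLeviCivita_target.mono hΩ₀ hsub).connDeriv_isometry S'.isLeviCivita_target hθ hθΩ
      hsurj hiso hFκd hξκd hFq, connDeriv_comp hκd hFd hξd, hK.fderiv]
    rfl
  have hh : ∀ u v, h' q u v = h (κ q) (K u) (K v) := by
    intro u v
    rw [S'.induced q hq, S.induced _ hκq, hdF, hdF, hiso _ hFq, hF'.self_of_nhds]
  -- The two shape operators are conjugate by the derivative `K` of the coordinate change in the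
  -- source, so their traces agree.
  have hA : ∀ u, shapeMap h' G' F' ξ' q u = K.symm (shapeMap h G F ξ (κ q) (K u)) := by
    intro u
    rw [← sub_eq_zero]
    refine S'.induced_nondegenerate q hq _ fun v => ?_
    rw [map_sub, sub_apply, hh (K.symm _), S'.form_shapeMap hq, hDξ, hdF,
      ContinuousLinearEquiv.apply_symm_apply, S.form_shapeMap hκq, hF'.self_of_nhds, ← hiso _ hFq,
      sub_self]
  rw [← trace_shapeMap, ← trace_shapeMap]
  have := trace_comp_comm ((K.symm : Coord m →L[ℝ] Coord m).comp (shapeMap h G F ξ (κ q)))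
    (K : Coord m →L[ℝ] Coord m)
  simp only [ContinuousLinearMap.comp_apply, ContinuousLinearEquiv.coe_coe,
    ContinuousLinearEquiv.apply_symm_apply] at this
  simp only [hA, this]

end ChangeOfCoordinates
-- From manifolds to coordinates: a nondegenerate immersion read in charts.
section Charts

variable {m n : ℕ}
  {M : Type*} [TopologicalSpace M] [ChartedSpace (Coord m) M] [IsManifold (𝓡 m) ∞ M]
  {N : Type*} [TopologicalSpace N] [ChartedSpace (Coord n) N] [IsManifold (𝓡 n) ∞ N]

lemma mdifferentiable_of_mem_atlas' {ψ : OpenPartialHomeomorph N (Coord n)}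
    (hψ : ψ ∈ atlas (Coord n) N) : ψ.MDifferentiable (𝓡 n) (𝓡 n) :=
  mdifferentiable_of_mem_atlas hψ

lemma contMDiffOn_of_mem_atlas {ψ : OpenPartialHomeomorph N (Coord n)}
    (hψ : ψ ∈ atlas (Coord n) N) : ContMDiffOn (𝓡 n) (𝓡 n) ∞ ψ ψ.source :=
  contMDiffOn_of_mem_maximalAtlas (IsManifold.subset_maximalAtlas hψ)

lemma contMDiffOn_symm_of_mem_atlas {ψ : OpenPartialHomeomorph N (Coord n)}
    (hψ : ψ ∈ atlas (Coord n) N) : ContMDiffOn (𝓡 n) (𝓡 n) ∞ ψ.symm ψ.target :=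
  contMDiffOn_symm_of_mem_maximalAtlas (IsManifold.subset_maximalAtlas hψ)

lemma mfderiv_symm_mfderiv {ψ : OpenPartialHomeomorph N (Coord n)}
    (hψ : ψ ∈ atlas (Coord n) N) {p : N} (hp : p ∈ ψ.source) (v : Coord n) :
    (mfderiv (𝓡 n) (𝓡 n) ψ.symm (ψ p) (mfderiv (𝓡 n) (𝓡 n) ψ p v : Coord n) : Coord n) = v :=
  DFunLike.congr_fun ((mdifferentiable_of_mem_atlas' hψ).symm_comp_deriv hp) v

/-- Coordinate expressions compute the metric. -/
lemma coordForm_mfderiv {ψ : OpenPartialHomeomorph N (Coord n)} (hψ : ψ ∈ atlas (Coord n) N)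
    (g : ∀ p : N, TangentSpace (𝓡 n) p →L[ℝ] TangentSpace (𝓡 n) p →L[ℝ] ℝ) {p : N}
    (hp : p ∈ ψ.source) (a b : TangentSpace (𝓡 n) p) :
    coordForm ψ g (ψ p) (mfderiv (𝓡 n) (𝓡 n) ψ p a) (mfderiv (𝓡 n) (𝓡 n) ψ p b) = g p a b := by
  -- The point `ψ.symm (ψ p)` equals `p` only propositionally, so the dependent family `g` is
  -- transported along a general equality `z = p`.
  have key : ∀ z : N, z = p → ∀ a' b' : Coord n, a' = a → b' = b →
      g z (a' : TangentSpace (𝓡 n) z) (b' : TangentSpace (𝓡 n) z) = g p a b := by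
    rintro z rfl a' b' rfl rfl
    rfl
  exact key _ (ψ.left_inv hp) _ _ (mfderiv_symm_mfderiv hψ hp a) (mfderiv_symm_mfderiv hψ hp b)

/-- Each component is the smooth section `g` evaluated on two coordinate fields `dψ⁻¹(w)`, which are
smooth sections of the tangent bundle along `ψ⁻¹`. -/
lemma contDiffOn_coordForm {ψ : OpenPartialHomeomorph N (Coord n)} (hψ : ψ ∈ atlas (Coord n) N)
    (g : Metric n N) : ContDiffOn ℝ ∞ (coordForm ψ g.val) ψ.target := by
  refine contDiffOn_clm_apply.2 fun u => contDiffOn_clm_apply.2 fun v => ?_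
  have hs := contMDiffOn_symm_of_mem_atlas hψ
  have hU : UniqueMDiffOn (𝓡 n) ψ.target := ψ.open_target.uniqueMDiffOn
  have ht := hs.contMDiffOn_tangentMapWithin (m := ∞) le_rfl hU
  have hsec : ∀ w : Coord n, ContMDiffOn (𝓡 n) (𝓡 n).tangent ∞
      (fun y => TotalSpace.mk' (Coord n) (E := (TangentSpace (𝓡 n) : N → Type)) (ψ.symm y)
        (mfderiv (𝓡 n) (𝓡 n) ψ.symm y w)) ψ.target := by
    intro w
    have hc : ContMDiffOn (𝓡 n) (𝓡 n).tangent ∞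
        (fun y : Coord n => (⟨y, w⟩ : TangentBundle (𝓡 n) (Coord n))) ψ.target := fun y _ =>
      contMDiffWithinAt_vectorSpace_iff_contDiffWithinAt.2 contDiffWithinAt_const
    refine (ht.comp hc fun y hy => hy).congr fun y hy => ?_
    simp only [Function.comp, tangentMapWithin, mfderivWithin_of_mem_nhds
      (ψ.open_target.mem_nhds hy)]
  have hg : ContMDiffOn (𝓡 n) ((𝓡 n).prod 𝓘(ℝ, CoordForm n)) ∞
      (fun y => TotalSpace.mk' (CoordForm n) (E := fun p : N => TangentSpace (𝓡 n) p →L[ℝ]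
        TangentSpace (𝓡 n) p →L[ℝ] ℝ) (ψ.symm y) (g.val (ψ.symm y))) ψ.target :=
    g.contMDiff.comp_contMDiffOn hs
  have := ContMDiffOn.clm_bundle_apply₂ (F₁ := Coord n) (F₂ := Coord n) (F₃ := ℝ)
    (E₃ := Bundle.Trivial N ℝ) hg (hsec u) (hsec v)
  rw [← contMDiffOn_iff_contDiffOn]
  intro y hy
  have h1 := this y hy
  rw [contMDiffWithinAt_totalSpace] at h1
  exact h1.2

lemma coordForm_nondegenerate {ψ : OpenPartialHomeomorph N (Coord n)} (hψ : ψ ∈ atlas (Coord n) N)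
    {g : ∀ p : N, TangentSpace (𝓡 n) p →L[ℝ] TangentSpace (𝓡 n) p →L[ℝ] ℝ} {y : Coord n}
    (hy : y ∈ ψ.target) (hg : ∀ u, (∀ v, g (ψ.symm y) u v = 0) → u = 0) (u : Coord n)
    (hu : ∀ v, coordForm ψ g y u v = 0) : u = 0 := by
  have hb := (mdifferentiable_of_mem_atlas' hψ).symm.mfderiv_bijective hy
  refine hb.1 ((hg _ fun w => ?_).trans (map_zero _).symm)
  obtain ⟨v, rfl⟩ := hb.2 w
  exact hu v

/-- The domain of the coordinate expression of a map in the charts `φ` and `ψ`. -/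
def coordDomain (φ : OpenPartialHomeomorph M (Coord m)) (ψ : OpenPartialHomeomorph N (Coord n))
    (x : M → N) : Set (Coord m) :=
  φ.target ∩ φ.symm ⁻¹' (x ⁻¹' ψ.source)

variable {φ : OpenPartialHomeomorph M (Coord m)} {ψ : OpenPartialHomeomorph N (Coord n)}
  {x : M → N}

omit [ChartedSpace (Coord m) M] [IsManifold (𝓡 m) ∞ M] [ChartedSpace (Coord n) N]
  [IsManifold (𝓡 n) ∞ N] in
lemma isOpen_coordDomain (hx : Continuous x) : IsOpen (coordDomain φ ψ x) :=
  φ.isOpen_inter_preimage_symm (ψ.open_source.preimage hx)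

lemma contDiffOn_coordMap (hφ : φ ∈ atlas (Coord m) M) (hψ : ψ ∈ atlas (Coord n) N)
    (hx : ContMDiff (𝓡 m) (𝓡 n) ∞ x) :
    ContDiffOn ℝ ∞ (coordMap φ ψ x) (coordDomain φ ψ x) := by
  rw [← contMDiffOn_iff_contDiffOn]
  exact (contMDiffOn_of_mem_atlas hψ).comp (hx.comp_contMDiffOn
    ((contMDiffOn_symm_of_mem_atlas hφ).mono Set.inter_subset_left)) fun q hq => hq.2

lemma fderiv_coordMap (hφ : φ ∈ atlas (Coord m) M) (hψ : ψ ∈ atlas (Coord n) N)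
    (hx : ContMDiff (𝓡 m) (𝓡 n) ∞ x) {q : Coord m} (hq : q ∈ coordDomain φ ψ x) (u : Coord m) :
    fderiv ℝ (coordMap φ ψ x) q u = mfderiv (𝓡 n) (𝓡 n) ψ (x (φ.symm q))
      (mfderiv (𝓡 m) (𝓡 n) x (φ.symm q) (mfderiv (𝓡 m) (𝓡 m) φ.symm q u)) := by
  have h1 := ((mdifferentiable_of_mem_atlas' hφ).mdifferentiableAt_symm hq.1).hasMFDerivAt
  have h2 := ((hx (φ.symm q)).mdifferentiableAt (by simp)).hasMFDerivAt
  have h3 := ((mdifferentiable_of_mem_atlas' hψ).mdifferentiableAt hq.2).hasMFDerivAt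
  rw [← mfderiv_eq_fderiv]
  exact DFunLike.congr_fun (HasMFDerivAt.comp q h3 (HasMFDerivAt.comp q h2 h1)).mfderiv u

lemma contDiffOn_coordField (hφ : φ ∈ atlas (Coord m) M) (hψ : ψ ∈ atlas (Coord n) N)
    {ξ : ∀ p : M, TangentSpace (𝓡 n) (x p)}
    (hξ : ContMDiff (𝓡 m) (𝓡 n).tangent ∞ (fun p => (⟨x p, ξ p⟩ : TangentBundle (𝓡 n) N))) :
    ContDiffOn ℝ ∞ (coordField φ ψ x ξ) (coordDomain φ ψ x) := by
  have hU : UniqueMDiffOn (𝓡 n) ψ.source := ψ.open_source.uniqueMDiffOn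
  have ht := (contMDiffOn_of_mem_atlas hψ).contMDiffOn_tangentMapWithin (m := ∞) le_rfl hU
  have hc := hξ.comp_contMDiffOn ((contMDiffOn_symm_of_mem_atlas hφ).mono
    (Set.inter_subset_left : coordDomain φ ψ x ⊆ _))
  have h1 := (contMDiff_snd_tangentBundle_modelSpace (Coord n) (𝓡 n) (n := ∞)).comp_contMDiffOn
    (ht.comp hc fun q hq => hq.2)
  rw [← contMDiffOn_iff_contDiffOn]
  refine h1.congr fun q hq => ?_
  simp only [Function.comp, tangentMapWithin, mfderivWithin_of_mem_nhds
      (ψ.open_source.mem_nhds hq.2)]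
  rfl

lemma isCoordHypersurface {g : Metric n N} {r : ℕ} (hx : IsNondegenerateImmersion m g x r)
    {ξ : ∀ p : M, TangentSpace (𝓡 n) (x p)} {ε : ℝ} (hξ : IsUnitNormal m g x ξ ε)
    (hφ : φ ∈ atlas (Coord m) M) (hψ : ψ ∈ atlas (Coord n) N) :
    IsCoordHypersurface (coordForm φ (inducedForm g.val x)) (coordDomain φ ψ x)
      (coordForm ψ g.val) ψ.target (coordMap φ ψ x) (coordField φ ψ x ξ) ε where
  isOpen_source := isOpen_coordDomain hx.contMDiff.continuous
  isOpen_target := ψ.open_target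
  metric_contDiffOn := contDiffOn_coordForm hψ g
  symm := fun y _ u v => g.symm _ _ _
  nondegenerate := fun y hy => coordForm_nondegenerate hψ hy (g.nondegenerate _)
  mapsTo := fun q hq => ψ.map_source hq.2
  map_contDiffOn := contDiffOn_coordMap hφ hψ hx.contMDiff
  normal_contDiffOn := contDiffOn_coordField hφ hψ hξ.contMDiff
  induced := by
    intro q hq u v
    rw [fderiv_coordMap hφ hψ hx.contMDiff hq, fderiv_coordMap hφ hψ hx.contMDiff hq, coordMap,
      coordForm_mfderiv hψ g.val hq.2]
    rfl
  induced_nondegenerate := fun q hq => coordForm_nondegenerate hφ hq.1 (hx.nondegenerate _)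
  normal := by
    intro q hq v
    rw [fderiv_coordMap hφ hψ hx.contMDiff hq, coordMap, coordField,
      coordForm_mfderiv hψ g.val hq.2]
    exact hξ.normal _ _
  unit := by
    intro q hq
    rw [coordMap, coordField, coordForm_mfderiv hψ g.val hq.2]
    exact hξ.unit _

end Charts

/-! ### The mean curvature as a differentiable function on the manifold. -/

section MeanCurvature

variable {m n : ℕ}
  {M : Type*} [TopologicalSpace M] [ChartedSpace (Coord m) M] [IsManifold (𝓡 m) ∞ M]
  {N : Type*} [TopologicalSpace N] [ChartedSpace (Coord n) N] [IsManifold (𝓡 n) ∞ N]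

lemma fderiv_coordMap_id {ψ ψ' : OpenPartialHomeomorph N (Coord n)} (hψ : ψ ∈ atlas (Coord n) N)
    (hψ' : ψ' ∈ atlas (Coord n) N) {y : Coord n} (hy : y ∈ coordDomain ψ ψ' (id : N → N))
    (u : Coord n) : fderiv ℝ (coordMap ψ ψ' id) y u = mfderiv (𝓡 n) (𝓡 n) ψ' (ψ.symm y)
      (mfderiv (𝓡 n) (𝓡 n) ψ.symm y u) := by
  rw [fderiv_coordMap hψ hψ' contMDiff_id hy, mfderiv_id]
  rfl

lemma fderiv_coordMap_id_bijective {ψ ψ' : OpenPartialHomeomorph N (Coord n)}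
    (hψ : ψ ∈ atlas (Coord n) N) (hψ' : ψ' ∈ atlas (Coord n) N) {y : Coord n}
    (hy : y ∈ coordDomain ψ ψ' (id : N → N)) :
    Function.Bijective (fderiv ℝ (coordMap ψ ψ' id) y) := by
  have h1 := (mdifferentiable_of_mem_atlas' hψ).symm.mfderiv_bijective hy.1
  have h2 := (mdifferentiable_of_mem_atlas' hψ').mfderiv_bijective hy.2
  have : ⇑(fderiv ℝ (coordMap ψ ψ' id) y) = fun u => mfderiv (𝓡 n) (𝓡 n) ψ' (ψ.symm y)
      (mfderiv (𝓡 n) (𝓡 n) ψ.symm y u) := funext (fderiv_coordMap_id hψ hψ' hy)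
  rw [this]
  exact h2.comp h1

/-- Differentiate `(ψ' ∘ ψ⁻¹) ∘ ψ = ψ'`, valid near `p`. -/
lemma fderiv_coordMap_id_mfderiv {ψ ψ' : OpenPartialHomeomorph N (Coord n)}
    (hψ : ψ ∈ atlas (Coord n) N) (hψ' : ψ' ∈ atlas (Coord n) N) {p : N} (hp : p ∈ ψ.source)
    (hp' : p ∈ ψ'.source) (v : TangentSpace (𝓡 n) p) :
    fderiv ℝ (coordMap ψ ψ' id) (ψ p) (mfderiv (𝓡 n) (𝓡 n) ψ p v)
      = mfderiv (𝓡 n) (𝓡 n) ψ' p v := by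
  have hy : ψ p ∈ coordDomain ψ ψ' (id : N → N) :=
    ⟨ψ.map_source hp, by simpa [ψ.left_inv hp] using hp'⟩
  have h1 := ((mdifferentiable_of_mem_atlas' hψ).mdifferentiableAt hp).hasMFDerivAt
  have h2 : HasMFDerivAt (𝓡 n) (𝓡 n) (coordMap ψ ψ' id) (ψ p) (fderiv ℝ (coordMap ψ ψ' id) (ψ p)) :=
    (differentiableAt_of_contDiffOn (contDiffOn_coordMap hψ hψ' contMDiff_id)
      (isOpen_coordDomain continuous_id) hy).hasFDerivAt.hasMFDerivAt
  have h3 := HasMFDerivAt.comp p h2 h1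
  have e : coordMap ψ ψ' id ∘ ψ =ᶠ[nhds p] ψ' := by
    filter_upwards [ψ.open_source.mem_nhds hp] with z hz
    simp [coordMap, ψ.left_inv hz]
  exact (DFunLike.congr_fun (h3.congr_of_eventuallyEq e.symm).mfderiv v).symm

variable {φ φ' : OpenPartialHomeomorph M (Coord m)} {ψ ψ' : OpenPartialHomeomorph N (Coord n)}
  {x : M → N} {g : Metric n N} {r : ℕ} {ξ : ∀ p : M, TangentSpace (𝓡 n) (x p)} {ε : ℝ}

/-- The trace of the shape operator does not depend on the charts. -/
lemma trace_shapeMatrix_chart (hx : IsNondegenerateImmersion m g x r)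
    (hξ : IsUnitNormal m g x ξ ε)
    (hφ : φ ∈ atlas (Coord m) M) (hψ : ψ ∈ atlas (Coord n) N)
    (hφ' : φ' ∈ atlas (Coord m) M) (hψ' : ψ' ∈ atlas (Coord n) N) {p : M}
    (h1 : p ∈ φ.source) (h2 : x p ∈ ψ.source) (h1' : p ∈ φ'.source) (h2' : x p ∈ ψ'.source) :
    (shapeMatrix (coordForm φ' (inducedForm g.val x)) (coordForm ψ' g.val) (coordMap φ' ψ' x)
      (coordField φ' ψ' x ξ) (φ' p)).trace
    = (shapeMatrix (coordForm φ (inducedForm g.val x)) (coordForm ψ g.val) (coordMap φ ψ x)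
      (coordField φ ψ x ξ) (φ p)).trace := by
  have hκ : coordMap φ' φ id (φ' p) = φ p := by simp [coordMap, φ'.left_inv h1']
  have hdom : φ' p ∈ coordDomain φ' φ (id : M → M) :=
    ⟨φ'.map_source h1', by simpa [φ'.left_inv h1'] using h1⟩
  have hdom' : φ' p ∈ coordDomain φ' ψ' x :=
    ⟨φ'.map_source h1', by simpa [φ'.left_inv h1'] using h2'⟩
  have hdom2 : φ p ∈ coordDomain φ ψ x :=
    ⟨φ.map_source h1, by simpa [φ.left_inv h1] using h2⟩
  have hFp : coordMap φ ψ x (φ p) = ψ (x p) := by simp [coordMap, φ.left_inv h1]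
  have hbij := fderiv_coordMap_id_bijective hφ' hφ hdom
  let K : Coord m ≃L[ℝ] Coord m := (LinearEquiv.ofBijective
    (fderiv ℝ (coordMap φ' φ id) (φ' p) : Coord m →ₗ[ℝ] Coord m) hbij).toContinuousLinearEquiv
  have hK : HasFDerivAt (coordMap φ' φ id) (K : Coord m →L[ℝ] Coord m) (φ' p) := by
    have : (K : Coord m →L[ℝ] Coord m) = fderiv ℝ (coordMap φ' φ id) (φ' p) := by
      ext1 u
      rfl
    rw [this]
    exact (differentiableAt_of_contDiffOn (contDiffOn_coordMap hφ' hφ contMDiff_id)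
      (isOpen_coordDomain continuous_id) hdom).hasFDerivAt
  have hev : ∀ᶠ z in nhds (φ' p), φ'.symm z ∈ φ.source ∧ x (φ'.symm z) ∈ ψ.source ∧
      x (φ'.symm z) ∈ ψ'.source := by
    have hc := φ'.continuousAt_symm (φ'.map_source h1')
    have hxc := hx.contMDiff.continuous
    filter_upwards [hc.preimage_mem_nhds ((φ.open_source.inter ((ψ.open_source.preimage hxc).inter
      (ψ'.open_source.preimage hxc))).mem_nhds (by
        rw [φ'.left_inv h1']; exact ⟨h1, h2, h2'⟩))] with z hz using hz
  have key := (isCoordHypersurface hx hξ hφ hψ).trace_shapeMatrix_eq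
    (isCoordHypersurface hx hξ hφ' hψ') (θ := coordMap ψ ψ' id) (κ := coordMap φ' φ id)
    (Ω₀ := coordDomain ψ ψ' (id : N → N)) (q := φ' p) (K := K)
    (isOpen_coordDomain continuous_id) Set.inter_subset_left
    (contDiffOn_coordMap hψ hψ' contMDiff_id) (fun y hy => ψ'.map_source hy.2)
    (fun y hy => (fderiv_coordMap_id_bijective hψ hψ' hy).2)
    (fun y hy u v => by
      rw [fderiv_coordMap_id hψ hψ' hy, fderiv_coordMap_id hψ hψ' hy]
      exact (coordForm_mfderiv hψ' g.val hy.2 _ _).symm)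
    hdom' (by rw [hκ]; exact hdom2)
    (by
      rw [hκ, hFp]
      exact ⟨ψ.map_source h2, by simpa [ψ.left_inv h2] using h2'⟩)
    hK ?_ ?_
  · rw [key, hκ]
  · filter_upwards [hev] with z hz
    simp [coordMap, φ.left_inv hz.1, ψ.left_inv hz.2.1]
  · filter_upwards [hev] with z hz
    have e1 : coordMap φ ψ x (coordMap φ' φ id z) = ψ (x (φ'.symm z)) := by
      simp [coordMap, φ.left_inv hz.1]
    have e2 : coordField φ ψ x ξ (coordMap φ' φ id z)
        = mfderiv (𝓡 n) (𝓡 n) ψ (x (φ'.symm z)) (ξ (φ'.symm z)) :=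
      congrArg (fun p => (mfderiv (𝓡 n) (𝓡 n) ψ (x p) (ξ p) : Coord n)) (φ.left_inv hz.1)
    rw [e1, e2]
    exact (fderiv_coordMap_id_mfderiv hψ hψ' hz.2.1 hz.2.2 _).symm

/-- The mean curvature in arbitrary charts. -/
lemma meanCurvature_symm (hx : IsNondegenerateImmersion m g x r) (hξ : IsUnitNormal m g x ξ ε)
    (hφ : φ ∈ atlas (Coord m) M) (hψ : ψ ∈ atlas (Coord n) N) {q : Coord m}
    (hq : q ∈ coordDomain φ ψ x) : meanCurvature (m := m) g x ξ ε (φ.symm q)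
      = 1 / (m : ℝ) * ε * (shapeMatrix (coordForm φ (inducedForm g.val x)) (coordForm ψ g.val)
        (coordMap φ ψ x) (coordField φ ψ x ξ) q).trace := by
  have := trace_shapeMatrix_chart hx hξ hφ hψ (chart_mem_atlas (Coord m) (φ.symm q))
    (chart_mem_atlas (Coord n) (x (φ.symm q))) (φ.map_target hq.1) hq.2 (mem_chart_source _ _)
    (mem_chart_source _ _)
  rw [φ.right_inv hq.1] at this
  rw [meanCurvature, shapeOperator, this]

omit [ChartedSpace (Coord m) M] [IsManifold (𝓡 m) ∞ M] [IsManifold (𝓡 n) ∞ N] in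
lemma coordField_smul (f : M → ℝ) (q : Coord m) :
    coordField φ ψ x (fun p => f p • ξ p) q = f (φ.symm q) • coordField φ ψ x ξ q :=
  map_smul (mfderiv (𝓡 n) (𝓡 n) ψ (x (φ.symm q))) (f (φ.symm q)) (ξ (φ.symm q))

lemma contDiffOn_meanCurvature_symm (hx : IsNondegenerateImmersion m g x r)
    (hξ : IsUnitNormal m g x ξ ε) (hφ : φ ∈ atlas (Coord m) M) (hψ : ψ ∈ atlas (Coord n) N) :
    ContDiffOn ℝ ∞ (fun q => meanCurvature (m := m) g x ξ ε (φ.symm q)) (coordDomain φ ψ x) := by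
  refine ContDiffOn.congr ?_ fun q hq => meanCurvature_symm hx hξ hφ hψ hq
  simp only [Matrix.trace]
  exact contDiffOn_const.mul (ContDiffOn.sum fun i _ =>
    (isCoordHypersurface hx hξ hφ hψ).contDiffOn_shapeMatrix i i)

omit [IsManifold (𝓡 m) ∞ M] [IsManifold (𝓡 n) ∞ N] in
lemma chartAt_mem_coordDomain (x : M → N) (p : M) : chartAt (Coord m) p p
    ∈ coordDomain (chartAt (Coord m) p) (chartAt (Coord n) (x p)) x :=
  ⟨mem_chart_target _ _, by simp⟩

/-- The chart in the definition varies with the point. Chart independence replaces it by the fixed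
chart at `p`, where the trace depends smoothly on the coordinates. -/
lemma mdifferentiable_meanCurvature (hx : IsNondegenerateImmersion m g x r)
    (hξ : IsUnitNormal m g x ξ ε) :
    MDifferentiable (𝓡 m) 𝓘(ℝ, ℝ) (meanCurvature (m := m) g x ξ ε) := by
  intro p
  have hp := mem_chart_source (Coord m) p
  have h1 : MDifferentiableAt (𝓡 m) 𝓘(ℝ, ℝ)
      (fun q => meanCurvature (m := m) g x ξ ε ((chartAt (Coord m) p).symm q))
      (chartAt (Coord m) p p) :=
    (differentiableAt_of_contDiffOn (contDiffOn_meanCurvature_symm hx hξ (chart_mem_atlas _ p)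
      (chart_mem_atlas _ (x p))) (isOpen_coordDomain hx.contMDiff.continuous)
      (chartAt_mem_coordDomain x p)).mdifferentiableAt
  refine (h1.comp p ((mdifferentiable_of_mem_atlas' (chart_mem_atlas _ p)).mdifferentiableAt
    hp)).congr_of_eventuallyEq ?_
  filter_upwards [(chartAt (Coord m) p).open_source.mem_nhds hp] with z hz
  simp [(chartAt (Coord m) p).left_inv hz]

lemma fderiv_comp_symm {f : M → ℝ} (hf : MDifferentiable (𝓡 m) 𝓘(ℝ, ℝ) f)
    (hφ : φ ∈ atlas (Coord m) M) {q : Coord m} (hq : q ∈ φ.target) (u : Coord m) :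
    fderiv ℝ (fun z => f (φ.symm z)) q u
      = mfderiv (𝓡 m) 𝓘(ℝ, ℝ) f (φ.symm q) (mfderiv (𝓡 m) (𝓡 m) φ.symm q u) := by
  have h1 := ((mdifferentiable_of_mem_atlas' hφ).mdifferentiableAt_symm hq).hasMFDerivAt
  rw [← mfderiv_eq_fderiv]
  exact DFunLike.congr_fun (HasMFDerivAt.comp q (hf _).hasMFDerivAt h1).mfderiv u

lemma mfderiv_eq_zero_of_fderiv_comp_symm {f : M → ℝ} (hf : MDifferentiable (𝓡 m) 𝓘(ℝ, ℝ) f)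
    {p : M} (h : fderiv ℝ (fun z => f ((chartAt (Coord m) p).symm z)) (chartAt (Coord m) p p) = 0) :
    mfderiv (𝓡 m) 𝓘(ℝ, ℝ) f p = 0 := by
  have hφ := chart_mem_atlas (Coord m) p
  have key : ∀ z : M, z = p → (∀ u : Coord m, mfderiv (𝓡 m) 𝓘(ℝ, ℝ) f z
      (mfderiv (𝓡 m) (𝓡 m) (chartAt (Coord m) p).symm (chartAt (Coord m) p p) u : Coord m)
        = (0 : ℝ)) → mfderiv (𝓡 m) 𝓘(ℝ, ℝ) f p = 0 := by
    rintro z rfl hz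
    ext w
    obtain ⟨u, rfl⟩ := ((mdifferentiable_of_mem_atlas' hφ).symm.mfderiv_bijective
      (mem_chart_target _ _)).2 w
    exact hz u
  refine key _ ((chartAt (Coord m) p).left_inv (mem_chart_source _ p)) fun u => ?_
  have := fderiv_comp_symm hf hφ (mem_chart_target _ p) u
  rw [h] at this
  exact this.symm

lemma isLocallyConstant_of_mfderiv_eq_zero {f : M → ℝ} (hf : MDifferentiable (𝓡 m) 𝓘(ℝ, ℝ) f)
    (h : ∀ p, mfderiv (𝓡 m) 𝓘(ℝ, ℝ) f p = 0) : IsLocallyConstant f := by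
  rw [IsLocallyConstant.iff_eventually_eq]
  intro p
  set φ := chartAt (Coord m) p with hφd
  have hφ : φ ∈ atlas (Coord m) M := chart_mem_atlas _ p
  obtain ⟨δ, hδ, hball⟩ := Metric.isOpen_iff.1 φ.open_target (φ p) (mem_chart_target _ p)
  have hfd : ∀ q ∈ φ.target, fderiv ℝ (fun z => f (φ.symm z)) q = 0 := by
    intro q hq
    ext1 u
    rw [fderiv_comp_symm hf hφ hq, h]
    rfl
  have hcont : φ.source ∩ φ ⁻¹' Metric.ball (φ p) δ ∈ nhds p :=
    Filter.inter_mem (φ.open_source.mem_nhds (mem_chart_source _ p))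
      ((φ.continuousAt (mem_chart_source _ p)).preimage_mem_nhds (Metric.ball_mem_nhds _ hδ))
  filter_upwards [hcont] with z hz
  have hdiff : DifferentiableOn ℝ (fun z => f (φ.symm z)) (Metric.ball (φ p) δ) := by
    intro q hq
    exact (((hf _).comp q ((mdifferentiable_of_mem_atlas' hφ).mdifferentiableAt_symm
      (hball hq))).differentiableAt).differentiableWithinAt
  have := Metric.isOpen_ball.is_const_of_fderiv_eq_zero
    (convex_ball (φ p) δ).isPreconnected hdiff (fun q hq => hfd q (hball hq)) hz.2
    (Metric.mem_ball_self hδ)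
  simpa [φ.left_inv hz.1, φ.left_inv (mem_chart_source _ p)] using this

end MeanCurvature

end PseudoRiem

/-! ### The theorem: from the pointwise alternatives to the global dichotomy. -/

theorem theorem4p1
    {M : Type*} [TopologicalSpace M] [ConnectedSpace M]
    [ChartedSpace (PseudoRiem.Coord 4) M] [IsManifold (𝓡 4) ∞ M]
    {N : Type*} [TopologicalSpace N]
    [ChartedSpace (PseudoRiem.Coord 5) N] [IsManifold (𝓡 5) ∞ N]
    (g : PseudoRiem.Metric 5 N) (s r : ℕ) (c lam ε : ℝ)
    (hN : PseudoRiem.IsSpaceForm g s c)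
    (x : M → N) (hx : PseudoRiem.IsNondegenerateImmersion 4 g x r)
    (ξ : ∀ p : M, TangentSpace (𝓡 5) (x p)) (hε : ε = 1 ∨ ε = -1)
    (hξ : PseudoRiem.IsUnitNormal 4 g x ξ ε)
    (hproper : PseudoRiem.LaplacianEq 4 g x
      (PseudoRiem.meanCurvatureVector (m := 4) g x ξ ε)
      (fun p => lam • PseudoRiem.meanCurvatureVector (m := 4) g x ξ ε p))
    (hcurv : ∀ p : M, ∃ μ : ℂ, PseudoRiem.principalCurvatures (m := 4) g x ξ p = {μ}) :
    (ε * lam ≤ 0 → ∀ p : M, PseudoRiem.meanCurvature (m := 4) g x ξ ε p = 0) ∧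
    (0 < ε * lam →
      (∀ p : M, PseudoRiem.meanCurvature (m := 4) g x ξ ε p = 0) ∨
      (∀ p : M, PseudoRiem.meanCurvature (m := 4) g x ξ ε p ^ 2 = ε * lam / 4)) := by
  have hHd := PseudoRiem.mdifferentiable_meanCurvature hx hξ
  set H : M → ℝ := PseudoRiem.meanCurvature (m := 4) g x ξ ε with hH
  -- The equation is read at the centre of the preferred charts at `p` and `x p`, because the
  -- eigenvalue hypothesis concerns the shape matrix exactly there.
  have hlap : ∀ p : M, PseudoRiem.laplacian
      (PseudoRiem.coordForm (chartAt (PseudoRiem.Coord 4) p) (PseudoRiem.inducedForm g.val x))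
      (PseudoRiem.coordForm (chartAt (PseudoRiem.Coord 5) (x p)) g.val)
      (PseudoRiem.coordMap (chartAt (PseudoRiem.Coord 4) p) (chartAt (PseudoRiem.Coord 5) (x p)) x)
      (fun z => H ((chartAt (PseudoRiem.Coord 4) p).symm z) •
        PseudoRiem.coordField (chartAt (PseudoRiem.Coord 4) p) (chartAt (PseudoRiem.Coord 5) (x p))
          x ξ z) (chartAt (PseudoRiem.Coord 4) p p)
      = lam • (H ((chartAt (PseudoRiem.Coord 4) p).symm (chartAt (PseudoRiem.Coord 4) p p)) •
        PseudoRiem.coordField (chartAt (PseudoRiem.Coord 4) p) (chartAt (PseudoRiem.Coord 5) (x p))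
          x ξ (chartAt (PseudoRiem.Coord 4) p p)) := by
    intro p
    have hq := PseudoRiem.chartAt_mem_coordDomain (m := 4) (n := 5) x p
    have h1 := hproper _ (chart_mem_atlas _ p) _ (chart_mem_atlas _ (x p)) _ hq.1 hq.2
    have e1 : PseudoRiem.coordField (chartAt (PseudoRiem.Coord 4) p)
        (chartAt (PseudoRiem.Coord 5) (x p)) x
        (PseudoRiem.meanCurvatureVector (m := 4) g x ξ ε) = fun z =>
        H ((chartAt (PseudoRiem.Coord 4) p).symm z) • PseudoRiem.coordField
          (chartAt (PseudoRiem.Coord 4) p) (chartAt (PseudoRiem.Coord 5) (x p)) x ξ z :=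
      funext fun z => PseudoRiem.coordField_smul H z
    have e2 := PseudoRiem.coordField_smul (φ := chartAt (PseudoRiem.Coord 4) p)
      (ψ := chartAt (PseudoRiem.Coord 5) (x p)) (x := x)
      (ξ := PseudoRiem.meanCurvatureVector (m := 4) g x ξ ε) (fun _ => lam)
      (chartAt (PseudoRiem.Coord 4) p p)
    rw [e2, e1] at h1
    exact h1
  have hS := fun p : M => PseudoRiem.isCoordHypersurface hx hξ
    (chart_mem_atlas (PseudoRiem.Coord 4) p) (chart_mem_atlas (PseudoRiem.Coord 5) (x p))
  have hf := fun p : M => fun q hq => PseudoRiem.meanCurvature_symm hx hξ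
    (chart_mem_atlas (PseudoRiem.Coord 4) p) (chart_mem_atlas (PseudoRiem.Coord 5) (x p))
    (q := q) hq
  have hcenter : ∀ p : M,
      (chartAt (PseudoRiem.Coord 4) p).symm (chartAt (PseudoRiem.Coord 4) p p) = p := fun p =>
    (chartAt (PseudoRiem.Coord 4) p).left_inv (mem_chart_source _ p)
  have hcrit : ∀ p, H p = 0 ∨ mfderiv (𝓡 4) 𝓘(ℝ, ℝ) H p = 0 := by
    intro p
    obtain ⟨μ, hμ⟩ := hcurv p
    rcases (hS p).meanCurvature_mul_fderiv hε (hN.curvature_eq _ (chart_mem_atlas _ (x p)))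
      (hf p) (PseudoRiem.chartAt_mem_coordDomain x p) (hlap p) hμ with h0 | h0
    · left
      rwa [hcenter] at h0
    · exact Or.inr (PseudoRiem.mfderiv_eq_zero_of_fderiv_comp_symm hHd h0)
  -- The square is used because `d(H²) = 2H dH` vanishes in both alternatives of `hcrit`, whereas
  -- `dH` is not yet known to vanish at zeros of `H`.
  have hsq : ∀ p p', H p ^ 2 = H p' ^ 2 := by
    have hloc : IsLocallyConstant fun p => H p ^ 2 := by
      have hd : ∀ p, HasMFDerivAt (𝓡 4) 𝓘(ℝ, ℝ) (fun p => H p ^ 2) p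
          ((fderiv ℝ (fun t : ℝ => t ^ 2) (H p)).comp (mfderiv (𝓡 4) 𝓘(ℝ, ℝ) H p)) := fun p =>
        HasMFDerivAt.comp p (g := fun t : ℝ => t ^ 2)
          (differentiable_pow (𝕜 := ℝ) 2 (H p)).hasFDerivAt.hasMFDerivAt (hHd p).hasMFDerivAt
      refine PseudoRiem.isLocallyConstant_of_mfderiv_eq_zero
        (fun p => (hd p).mdifferentiableAt) fun p => ?_
      rw [(hd p).mfderiv]
      ext1 w
      rcases hcrit p with h0 | h0
      · have : fderiv ℝ (fun t : ℝ => t ^ 2) (H p) = 0 := by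
          ext
          simp [h0]
        exact DFunLike.congr_fun this (mfderiv (𝓡 4) 𝓘(ℝ, ℝ) H p w : ℝ)
      · exact (congrArg (fderiv ℝ (fun t : ℝ => t ^ 2) (H p)) (DFunLike.congr_fun h0 w)).trans
          (map_zero _)
    exact fun p p' => hloc.apply_eq_of_preconnectedSpace p p'
  have main : (∀ p, H p = 0) ∨ ∀ p, H p ≠ 0 ∧ H p ^ 2 = ε * lam / 4 := by
    by_cases h0 : ∃ p, H p = 0
    · obtain ⟨p₀, hp₀⟩ := h0
      left
      intro p
      have := hsq p p₀
      rw [hp₀] at this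
      simpa using this
    · right
      push Not at h0
      intro p
      refine ⟨h0 p, ?_⟩
      obtain ⟨μ, hμ⟩ := hcurv p
      -- As `H` has no zeros, `hcrit` gives `dH = 0` on the whole chart. Vanishing near the point,
      -- not just at it, is what removes the Hessian of `H` from the normal equation.
      have hev : ∀ᶠ z in nhds (chartAt (PseudoRiem.Coord 4) p p),
          fderiv ℝ (fun z => H ((chartAt (PseudoRiem.Coord 4) p).symm z)) z = 0 := by
        filter_upwards [(chartAt (PseudoRiem.Coord 4) p).open_target.mem_nhds
          (mem_chart_target _ p)] with z hz
        ext1 u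
        rw [PseudoRiem.fderiv_comp_symm hHd (chart_mem_atlas _ p) hz,
          (hcrit _).resolve_left (h0 _)]
        rfl
      have := (hS p).meanCurvature_sq hε (hf p) (PseudoRiem.chartAt_mem_coordDomain x p) (hlap p)
        hμ hev
      rw [hcenter] at this
      exact this.resolve_left (h0 p)
  refine ⟨fun hle => ?_, fun _ => main.imp id fun h p => (h p).2⟩
  rcases main with h | h
  · exact h
  · intro p
    obtain ⟨h1, h2⟩ := h p
    have : 0 < H p ^ 2 := by positivity
    linarith
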